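/- Let $N$ be a finite set with $|N|\ge 3$. A game over $N$ is a function $m:\mathcal P(N)\to\mathbb R$ with $m(\emptyset)=0$. Its core is the set of $x\in\mathbb R^N$ with $\sum_{i\in N}x_i=m(N)$ and $\sum_{i\in S}x_i\ge m(S)$ for all $S\subseteq N$. The game is exact if for each $S\subseteq N$ some $x$ in the core satisfies $\sum_{i\in S}x_i=m(S)$. Let $\mathcal E(N)\subseteq\mathbb R^{\mathcal P(N)}$ be the cone of exact games. A facet of $\mathcal E(N)$ is a face of dimension $\dim\mathcal E(N)-1$. For $\theta\in\mathbb R^{\mathcal P(N)}$ put $\langle\theta,m\rangle=\sum_{S\subseteq N}\theta(S)m(S)$. The inequality $0\le\langle\theta,m\rangle$ is facet-defining for $\mathcal E(N)$ if it is valid for all $m\in\mathcal E(N)$ and $\{m\in\mathcal E(N):\langle\theta,m\rangle=0\}$ is a facet of $\mathcal E(N)$. For $S\subseteq N$ let $\chi_S\in\mathbb R^N$ be the incidence vector of $S$. A set system $\mathcal S$ is non-trivial if $\emptyset\ne\mathcal S\subseteq\mathcal P(N)\setminus\{\emptyset,N\}$. A linear combination is semi-conic if at most one of its coefficients is negative.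 A non-trivial system $\mathcal S$ is - balanced, if $\chi_N=\sum_{S\in\mathcal S}\lambda_S\chi_S$ for some $\lambda_S>0$; - semi-balanced, if some constant vector $[r,\dots,r]\in\mathbb R^N$ equals a semi-conic combination $\sum_{S\in\mathcal S}\lambda_S\chi_S$ with all $\lambda_S\neq0$; - min-semi-balanced, if it is semi-balanced and no proper subsystem of it is semi-balanced. A set $T\in\mathcal S$ is exceptional within a non-trivial system $\mathcal S$ if some combination $\sum_{S\in\mathcal S}\lambda_S\chi_S$ is a constant vector, with $\lambda_T<0$ and $\lambda_S\ge0$ for $S\in\mathcal S\setminus\{T\}$. A min-semi-balanced system $\mathcal S$ is indecomposable if it is not balanced and there is no $E\subseteq N$ with $E\notin\mathcal S\cup\{\emptyset,N\}$ that is exceptional within $\mathcal S\cup\{E\}$. Let $\Theta_{\mathcal S}$ be the set of all $\theta\in\mathbb R^{\mathcal P(N)}$ obtained from a semi-conic combination $\sum_{S\in\mathcal S}\lambda_S\chi_S=[r,\dots,r]$ with $\sum_{S\in\mathcal S}\lambda_S=1$ by putting $\theta(S)=-\lambda_S$ for $S\in\mathcal S$, $\theta(N)=r$, $\theta(\emptyset)=1-r$,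 and $\theta(L)=0$ for all other $L\subseteq N$. If $\Theta_{\mathcal S}$ has exactly one element, that element is denoted by $\theta_{\mathcal S}$. Theorem. 1. Let $\theta\in\mathbb R^{\mathcal P(N)}$ satisfy $\sum_{S\subseteq N}\theta(S)=0$ and $\sum_{\emptyset\ne L\subsetneq N}\theta(L)=-1$. Then $0\le\langle\theta,m\rangle$ is facet-defining for $\mathcal E(N)$ if and only if there is an indecomposable min-semi-balanced system $\mathcal S$ on $N$ for which $\Theta_{\mathcal S}$ is a singleton and $\theta=\theta_{\mathcal S}$. 2. Consequently facets of $\mathcal E(N)$ correspond one-to-one to indecomposable min-semi-balanced systems on $N$: for every such $\mathcal S$ the vector $\theta_{\mathcal S}$ exists and $\{m\in\mathcal E(N):\langle\theta_{\mathcal S},m\rangle=0\}$ is a facet of $\mathcal E(N)$, and every facet of $\mathcal E(N)$ has this form for exactly one such $\mathcal S$. -/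

import Mathlib

/-! Exact games over a finite player set `N`, semi-balanced set systems and facets.
Coalitions are elements of `Finset N`, set systems are elements of `Finset (Finset N)`. -/

namespace ExactGames

section PolyhedralGeometry

/-- The dimension of a non-empty set: the dimension of the direction of its affine hull. -/
noncomputable def affDim {ι : Type*} (P : Set (ι → ℝ)) : ℕ :=
  Module.finrank ℝ (vectorSpan ℝ P)

/-- `F` is a facet of `P`: a (non-empty, exposed) face of dimension `dim P - 1`. -/
def IsFacet {ι : Type*} (P F : Set (ι → ℝ)) : Prop :=
  IsExposed ℝ P F ∧ F.Nonempty ∧ affDim F + 1 = affDim P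

/-- The part of `P` on which the inequality `0 ≤ ⟨θ, m⟩` holds with equality. -/
def zeroFace {ι : Type*} [Fintype ι] (P : Set (ι → ℝ)) (θ : ι → ℝ) : Set (ι → ℝ) :=
  {m | m ∈ P ∧ θ ⬝ᵥ m = 0}

/-- The inequality `0 ≤ ⟨θ, m⟩` is facet-defining for `m ∈ P`: it is valid for `P`, and the
points of `P` where it holds with equality form a facet of `P`. -/
def IsFacetDefining {ι : Type*} [Fintype ι] (P : Set (ι → ℝ)) (θ : ι → ℝ) : Prop :=
  (∀ m ∈ P, 0 ≤ θ ⬝ᵥ m) ∧ IsFacet P (zeroFace P θ)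

end PolyhedralGeometry

section Games

variable {N : Type*} [Fintype N]

/-- The core of a game. -/
def core (m : Finset N → ℝ) : Set (N → ℝ) :=
  {x | ∑ i, x i = m Finset.univ ∧ ∀ S : Finset N, m S ≤ ∑ i ∈ S, x i}

/-- The set of exact games over `N`: games for which every coalition has a tight vector
in the core. -/
def exactCone (N : Type*) [Fintype N] : Set (Finset N → ℝ) :=
  {m | m ∅ = 0 ∧ ∀ S : Finset N, ∃ x ∈ core m, ∑ i ∈ S, x i = m S}

end Games

section SetSystems

variable {N : Type*} [Fintype N] [DecidableEq N]

/-- The incidence vector of a coalition. -/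
def chi (S : Finset N) : N → ℝ := fun i => if i ∈ S then 1 else 0

/-- Non-trivial set systems: non-empty systems of non-empty proper subsets of `N`. -/
def IsNontrivial (𝒮 : Finset (Finset N)) : Prop :=
  𝒮.Nonempty ∧ ∅ ∉ 𝒮 ∧ Finset.univ ∉ 𝒮

/-- At most one of the coefficients `c S`, `S ∈ 𝒮`, is strictly negative. -/
def IsSemiConic (𝒮 : Finset (Finset N)) (c : Finset N → ℝ) : Prop :=
  {S | S ∈ 𝒮 ∧ c S < 0}.Subsingleton

/-- The linear combination of the incidence vectors of the members of `𝒮` with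
coefficients `c` is the constant vector `[r, …, r]`. -/
def YieldsConst (𝒮 : Finset (Finset N)) (c : Finset N → ℝ) (r : ℝ) : Prop :=
  ∑ S ∈ 𝒮, c S • chi S = fun _ => r

/-- Balanced systems: `χ_N` is a combination with strictly positive coefficients. -/
def IsBalanced (𝒮 : Finset (Finset N)) : Prop :=
  IsNontrivial 𝒮 ∧ ∃ c : Finset N → ℝ, (∀ S ∈ 𝒮, 0 < c S) ∧
    ∑ S ∈ 𝒮, c S • chi S = chi Finset.univ

/-- Semi-balanced systems: some constant vector is a semi-conic combination with all
coefficients non-zero. -/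
def IsSemiBalanced (𝒮 : Finset (Finset N)) : Prop :=
  IsNontrivial 𝒮 ∧ ∃ (c : Finset N → ℝ) (r : ℝ), (∀ S ∈ 𝒮, c S ≠ 0) ∧
    IsSemiConic 𝒮 c ∧ YieldsConst 𝒮 c r

/-- Semi-balanced systems that are minimal with respect to inclusion. -/
def IsMinSemiBalanced (𝒮 : Finset (Finset N)) : Prop :=
  Minimal IsSemiBalanced 𝒮

/-- Min-semi-balanced systems that are not balanced. -/
def IsPurelyMinSemiBalanced (𝒮 : Finset (Finset N)) : Prop :=
  IsMinSemiBalanced 𝒮 ∧ ¬ IsBalanced 𝒮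

/-- `T` is exceptional within the non-trivial system `𝒮`. -/
def IsExceptional (T : Finset N) (𝒮 : Finset (Finset N)) : Prop :=
  IsNontrivial 𝒮 ∧ T ∈ 𝒮 ∧ ∃ (c : Finset N → ℝ) (r : ℝ),
    c T < 0 ∧ (∀ S ∈ 𝒮, S ≠ T → 0 ≤ c S) ∧ YieldsConst 𝒮 c r

/-- `E` yields a decomposition of `𝒮`. -/
def YieldsDecomposition (E : Finset N) (𝒮 : Finset (Finset N)) : Prop :=
  E ∉ 𝒮 ∧ E ≠ ∅ ∧ E ≠ Finset.univ ∧ IsExceptional E (insert E 𝒮)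

/-- Indecomposable min-semi-balanced systems: purely min-semi-balanced systems without
a decomposition. -/
def IsIndecomposable (𝒮 : Finset (Finset N)) : Prop :=
  IsPurelyMinSemiBalanced 𝒮 ∧ ¬ ∃ E, YieldsDecomposition E 𝒮

/-- The coefficient vector assigned to a combination with coefficients `c` that yields
the constant vector `[r, …, r]`. -/
noncomputable def coeffVec (𝒮 : Finset (Finset N)) (c : Finset N → ℝ) (r : ℝ) :
    Finset N → ℝ := fun L =>
  if L = Finset.univ then r
  else if L = ∅ then 1 - r
  else if L ∈ 𝒮 then - c L
  else 0

/-- The set `Θ_𝒮` of the coefficient vectors of all affine semi-conic combinations of the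
incidence vectors of members of `𝒮` yielding a constant vector. If it has exactly one
element, that element is `θ_𝒮`. -/
def Theta (𝒮 : Finset (Finset N)) : Set (Finset N → ℝ) :=
  {θ | ∃ (c : Finset N → ℝ) (r : ℝ), ∑ S ∈ 𝒮, c S = 1 ∧ IsSemiConic 𝒮 c ∧
    YieldsConst 𝒮 c r ∧ θ = coeffVec 𝒮 c r}

/-- `θ = θ_𝒮`: the set `Θ_𝒮` has exactly one element, namely `θ`. -/
def IsThetaOf (θ : Finset N → ℝ) (𝒮 : Finset (Finset N)) : Prop :=
  Theta 𝒮 = {θ}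

end SetSystems

end ExactGames

open ExactGames

/-! Exact games and indecomposable min-semi-balanced systems.

A game is exact if and only if, for every coalition `T`, its core contains an element that is
tight at `T`. Farkas' lemma, applied simultaneously for all `T` (`exists_eq_sum_tightDual`),
identifies the valid inequalities for the cone of exact games with the sums of elements of the
cones `tightDual T`: linear relations between incidence vectors and a constant vector in which
only `T` may enter with the opposite sign. These are exactly the relations given by semi-conic
combinations. On every `tightDual T` the sum over the non-empty proper coalitions is non-positive
and vanishes only at zero (`properSum_nonpos`, `eq_zero_of_properSum_eq_zero`). Hence the dual cone
is pointed, the exact games span the space of all games, and every facet has a unique inequality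
with the given normalisation. Facet-defining inequalities are the extreme ones
(`isFacet_zeroFace_iff`).

An extreme `θ` lies in a single `tightDual T`. A relation `α` whose negative coefficients, `T`
aside, are negative in `θ` can be subtracted from `θ` with a small factor, so it is a multiple of `θ`
(`IsFacetDefining.exists_eq_smul_of_neg`). A smaller semi-balanced system or an exceptional set
would give such a relation that is not a multiple of `θ`; so would the complement of a
member if the support of `θ` were balanced, unless the complement also belongs to it. In that
case `θ` is the inequality `m(A) + m(Aᶜ) ≤ m(N)`, which is a sum of two supermodularity
inequalities as soon as there are three players (`IsFacetDefining.apply_compl_eq_zero`).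

Conversely, let `𝒮` be indecomposable. Its relations form a line
(`IsMinSemiBalanced.exists_eq_mul`), and in any representation of `θ_𝒮` as a sum of
elements of the cones `tightDual T` all summands are supported on `𝒮`
(`IsIndecomposable.apply_eq_zero_of_sum`), hence are multiples of `θ_𝒮`. Thus `θ_𝒮` is extreme. As
`𝒮` is the support of `θ_𝒮`, it is determined by the facet. -/

namespace ExactGames

/-! ### Farkas' lemma -/

/-- Farkas' lemma for finitely many linear functionals on a real vector space, by induction on their
number: if the inequalities without the new one do not imply `0 ≤ f`, then `f` and the new functional
are negative at some `z` satisfying them, and the induction hypothesis is applied to the functionals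
composed with the projection along `z` onto the kernel of the new one. -/
theorem farkas {W ι : Type*} [AddCommGroup W] [Module ℝ W] (s : Finset ι) (a : ι → W →ₗ[ℝ] ℝ)
    (f : W →ₗ[ℝ] ℝ) (h : ∀ x, (∀ i ∈ s, 0 ≤ a i x) → 0 ≤ f x) :
    ∃ c : ι → ℝ, (∀ i, 0 ≤ c i) ∧ f = ∑ i ∈ s, c i • a i := by
  classical
  induction s using Finset.induction_on generalizing a f with
  | empty =>
    refine ⟨0, fun _ => le_rfl, ?_⟩
    ext x
    have h1 := h x (by simp)
    have h2 := h (-x) (by simp)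
    simp only [map_neg] at h2
    simp only [Finset.sum_empty, LinearMap.zero_apply]
    linarith
  | insert k s hk ih =>
    by_cases hs : ∀ x, (∀ i ∈ s, 0 ≤ a i x) → 0 ≤ f x
    · obtain ⟨c, hc, rfl⟩ := ih a f hs
      refine ⟨Function.update c k 0, fun i => ?_, ?_⟩
      · by_cases hi : i = k
        · subst hi; simp
        · simp [hi, hc]
      · rw [Finset.sum_insert hk]
        simp only [Function.update_self, zero_smul, zero_add]
        refine Finset.sum_congr rfl fun i hi => ?_
        rw [Function.update_of_ne (by rintro rfl; exact hk hi)]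
    · push Not at hs
      obtain ⟨z, hz, hfz⟩ := hs
      have hkz : a k z < 0 := by
        by_contra! hkz
        refine absurd (h z ?_) (not_le.2 hfz)
        simpa using ⟨hkz, hz⟩
      -- Project along `z` onto the kernel of `a k`.
      let g (b : W →ₗ[ℝ] ℝ) : W →ₗ[ℝ] ℝ := b - (b z / a k z) • a k
      obtain ⟨c, hc, hfc⟩ := ih (fun i => g (a i)) (g f) fun x hx => by
        have key : ∀ b : W →ₗ[ℝ] ℝ, g b x = b (x - (a k x / a k z) • z) := fun b => by
          simp [g]; ring
        rw [key]
        refine h _ fun i hi => ?_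
        rcases Finset.mem_insert.1 hi with rfl | hi
        · simp [div_mul_cancel₀ _ hkz.ne]
        · rw [← key]; exact hx i hi
      have hsum : (0 : ℝ) ≤ (f z - ∑ i ∈ s, c i * a i z) / a k z := by
        refine div_nonneg_of_nonpos ?_ hkz.le
        have := Finset.sum_nonneg fun i hi => mul_nonneg (hc i) (hz i hi)
        linarith
      refine ⟨Function.update c k ((f z - ∑ i ∈ s, c i * a i z) / a k z), fun i => ?_, ?_⟩
      · by_cases hi : i = k
        · subst hi; simpa using hsum
        · simp [hi, hc]
      · have hup : ∀ C : ℝ, ∑ i ∈ s, Function.update c k C i • a i = ∑ i ∈ s, c i • a i :=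
          fun C => Finset.sum_congr rfl fun i hi => by
            rw [Function.update_of_ne (by rintro rfl; exact hk hi)]
        rw [Finset.sum_insert hk, Function.update_self, hup]
        ext x
        have hx := LinearMap.congr_fun hfc x
        simp only [g, LinearMap.sub_apply, LinearMap.smul_apply, LinearMap.sum_apply,
          smul_eq_mul, mul_sub, Finset.sum_sub_distrib] at hx
        simp only [LinearMap.add_apply, LinearMap.smul_apply, LinearMap.sum_apply, smul_eq_mul]
        have h3 : ∑ i ∈ s, c i * (a i z / a k z * a k x)
            = (∑ i ∈ s, c i * a i z) / a k z * a k x := by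
          rw [Finset.sum_div, Finset.sum_mul]
          exact Finset.sum_congr rfl fun i _ => by ring
        rw [h3] at hx
        rw [sub_div, sub_mul]
        linarith

variable {N : Type*} [Fintype N] [DecidableEq N]

/-! ### Linear relations between incidence vectors -/

/-- The vectors of coefficients of linear relations between the vectors `(1, χ_S)`, `S ⊆ N`;
equivalently, the vectors annihilating all set functions `S ↦ a + ∑ i ∈ S, x i`. -/
def nullSpace (N : Type*) [Fintype N] [DecidableEq N] : Submodule ℝ (Finset N → ℝ) where
  carrier := {α | ∑ S, α S = 0 ∧ ∀ i, ∑ S, α S * chi S i = 0}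
  add_mem' := by
    rintro α β ⟨h1, h2⟩ ⟨h3, h4⟩
    simp [add_mul, Finset.sum_add_distrib, h1, h2, h3, h4]
  zero_mem' := by simp
  smul_mem' := by
    rintro c α ⟨h1, h2⟩
    simp [mul_assoc, ← Finset.mul_sum, h1, h2]

theorem sum_mul_additive {α : Finset N → ℝ} (hα : α ∈ nullSpace N) (x : N → ℝ) :
    ∑ S, α S * ∑ i ∈ S, x i = 0 := by
  have h : ∀ S, α S * ∑ i ∈ S, x i = ∑ i, x i * (α S * chi S i) := fun S => by
    rw [Finset.mul_sum, ← Finset.sum_subset (Finset.subset_univ S)]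
    · exact Finset.sum_congr rfl fun i hi => by simp [chi, hi, mul_comm]
    · intro i _ hi
      simp [chi, hi]
  simp_rw [h]
  rw [Finset.sum_comm]
  simp [← Finset.mul_sum, hα.2]

theorem single_modular_mem_nullSpace (A B : Finset N) :
    (Pi.single (A ∪ B) 1 + Pi.single (A ∩ B) 1 - Pi.single A 1 - Pi.single B 1 : Finset N → ℝ)
      ∈ nullSpace N := by
  refine ⟨?_, fun i => ?_⟩
  · simp [Finset.sum_add_distrib, Finset.sum_sub_distrib]
  · simp only [Pi.sub_apply, Pi.add_apply, sub_mul, add_mul, Finset.sum_add_distrib,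
      Finset.sum_sub_distrib, Pi.single_apply, ite_mul, one_mul, zero_mul, Finset.sum_ite_eq',
      Finset.mem_univ, if_true, chi, Finset.mem_union, Finset.mem_inter]
    by_cases h1 : i ∈ A <;> by_cases h2 : i ∈ B <;> simp [h1, h2]

/-- The sum of the coefficients of the non-empty proper coalitions. -/
def properSum (N : Type*) [Fintype N] [DecidableEq N] : (Finset N → ℝ) →ₗ[ℝ] ℝ :=
  ∑ L ∈ (Finset.univ : Finset (Finset N)) \ {∅, Finset.univ}, LinearMap.proj L

theorem properSum_apply (α : Finset N → ℝ) :
    properSum N α = ∑ L ∈ (Finset.univ : Finset (Finset N)) \ {∅, Finset.univ}, α L := by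
  simp [properSum]

theorem sum_eq_properSum_add [Nonempty N] (α : Finset N → ℝ) :
    ∑ S, α S = properSum N α + (α ∅ + α Finset.univ) := by
  rw [properSum_apply, ← Finset.sum_sdiff (Finset.subset_univ {∅, Finset.univ}),
    Finset.sum_pair Finset.univ_nonempty.ne_empty.symm]

/-- The cone of those linear relations all of whose coefficients at non-empty proper
coalitions other than `T` are non-positive. By Farkas' lemma it is dual to the cone of games
having a core element that is tight at `T`. -/
def tightDual (T : Finset N) : Set (Finset N → ℝ) :=
  {α | α ∈ nullSpace N ∧ ∀ L, L ≠ ∅ → L ≠ Finset.univ → L ≠ T → α L ≤ 0}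

section tightDual

variable {T : Finset N} {α β : Finset N → ℝ}

theorem zero_mem_tightDual : (0 : Finset N → ℝ) ∈ tightDual T :=
  ⟨zero_mem _, by simp⟩

theorem add_mem_tightDual (hα : α ∈ tightDual T) (hβ : β ∈ tightDual T) :
    α + β ∈ tightDual T :=
  ⟨add_mem hα.1 hβ.1, fun L h1 h2 h3 => add_nonpos (hα.2 L h1 h2 h3) (hβ.2 L h1 h2 h3)⟩

theorem smul_mem_tightDual {c : ℝ} (hc : 0 ≤ c) (hα : α ∈ tightDual T) :
    c • α ∈ tightDual T :=
  ⟨Submodule.smul_mem _ _ hα.1,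
    fun L h1 h2 h3 => mul_nonpos_of_nonneg_of_nonpos hc (hα.2 L h1 h2 h3)⟩

/-- Comparing the relation at a player inside `T` with that at a player outside `T` shows that
the coefficients of `∅` and `N` are non-negative, and that their vanishing forces the
vanishing of all others. -/
theorem properSum_nonpos_aux (hT : T ≠ ∅) (hT' : T ≠ Finset.univ) (hα : α ∈ tightDual T) :
    properSum N α ≤ 0 ∧ (properSum N α = 0 → α = 0) := by
  obtain ⟨i, hi⟩ := Finset.nonempty_iff_ne_empty.2 hT
  obtain ⟨j, hj⟩ : ∃ j, j ∉ T := by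
    by_contra! h; exact hT' (Finset.eq_univ_iff_forall.2 h)
  have : Nonempty N := ⟨i⟩
  have h0 := sum_eq_properSum_add α
  rw [hα.1.1] at h0
  have hne : (Finset.univ : Finset N) ≠ ∅ := Finset.univ_nonempty.ne_empty
  have hout : ∀ j ∉ T, ∑ S ∈ Finset.univ.erase Finset.univ, -(α S * chi S j) = α Finset.univ := by
    intro j _
    have := hα.1.2 j
    rw [← Finset.add_sum_erase _ _ (Finset.mem_univ Finset.univ)] at this
    simp only [Finset.sum_neg_distrib]
    simp only [chi, Finset.mem_univ, if_true, mul_one] at this ⊢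
    linarith
  have hin : ∀ i ∈ T, ∑ S ∈ Finset.univ.erase ∅, -(α S * (1 - chi S i)) = α ∅ := by
    intro i _
    have h1 := hα.1.2 i
    have h2 : ∑ S, α S * (1 - chi S i) = 0 := by
      simp [mul_sub, Finset.sum_sub_distrib, h1, hα.1.1]
    rw [← Finset.add_sum_erase _ _ (Finset.mem_univ ∅)] at h2
    simp only [Finset.sum_neg_distrib]
    simp only [chi, Finset.notMem_empty, if_false, sub_zero, mul_one] at h2 ⊢
    linarith
  have pout : ∀ j ∉ T, ∀ S ∈ Finset.univ.erase (Finset.univ : Finset N),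
      0 ≤ -(α S * chi S j) := by
    intro j hj S hS
    by_cases hjS : j ∈ S
    · have := hα.2 S (Finset.ne_empty_of_mem hjS) (Finset.ne_of_mem_erase hS)
        (by rintro rfl; exact hj hjS)
      simpa [chi, hjS] using this
    · simp [chi, hjS]
  have pin : ∀ i ∈ T, ∀ S ∈ Finset.univ.erase (∅ : Finset N),
      0 ≤ -(α S * (1 - chi S i)) := by
    intro i hi S hS
    by_cases hiS : i ∈ S
    · simp [chi, hiS]
    · have := hα.2 S (Finset.ne_of_mem_erase hS) (by rintro rfl; simp at hiS)
        (by rintro rfl; exact hiS hi)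
      simpa [chi, hiS] using this
  have hN0 : 0 ≤ α Finset.univ := hout j hj ▸ Finset.sum_nonneg (pout j hj)
  have he0 : 0 ≤ α ∅ := hin i hi ▸ Finset.sum_nonneg (pin i hi)
  refine ⟨by linarith, fun hs => ?_⟩
  have hN : α Finset.univ = 0 := by linarith
  have he : α ∅ = 0 := by linarith
  have hoff : ∀ S, S ≠ T → α S = 0 := by
    intro S hST
    by_cases hSe : S = ∅
    · rwa [hSe]
    by_cases hSu : S = Finset.univ
    · rwa [hSu]
    by_cases hTS : T ⊆ S
    · obtain ⟨k, hkS, hkT⟩ := Finset.not_subset.1 fun h => hST (h.antisymm hTS)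
      have := (Finset.sum_eq_zero_iff_of_nonneg (pout k hkT)).1 ((hout k hkT).trans hN) S
        (by simpa using hSu)
      simpa [chi, hkS] using this
    · obtain ⟨k, hkT, hkS⟩ := Finset.not_subset.1 hTS
      have := (Finset.sum_eq_zero_iff_of_nonneg (pin k hkT)).1 ((hin k hkT).trans he) S
        (by simpa using hSe)
      simpa [chi, hkS] using this
  funext S
  by_cases hST : S = T
  · have := hα.1.1
    rw [Finset.sum_eq_single T (fun S _ h => hoff S h) (by simp)] at this
    simpa [hST] using this
  · exact hoff S hST

/-- If `T` is `∅` or `N`, no coefficient is exempted in `tightDual T`, and `T` may be replaced by a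
singleton, which is a proper coalition as there are at least two players. -/
theorem properSum_nonpos_and [Nontrivial N] (hα : α ∈ tightDual T) :
    properSum N α ≤ 0 ∧ (properSum N α = 0 → α = 0) := by
  by_cases hT : T ≠ ∅ ∧ T ≠ Finset.univ
  · exact properSum_nonpos_aux hT.1 hT.2 hα
  · obtain ⟨i⟩ : Nonempty N := inferInstance
    obtain ⟨j, hj⟩ := exists_ne i
    refine properSum_nonpos_aux (T := {i}) (by simp) (fun h => hj ?_) ⟨hα.1, fun L h1 h2 _ =>
      hα.2 L h1 h2 (by rintro rfl; exact hT ⟨h1, h2⟩)⟩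
    have := Finset.mem_univ j
    rwa [← h, Finset.mem_singleton] at this

theorem properSum_nonpos [Nontrivial N] (hα : α ∈ tightDual T) : properSum N α ≤ 0 :=
  (properSum_nonpos_and hα).1

theorem eq_zero_of_properSum_eq_zero [Nontrivial N] (hα : α ∈ tightDual T)
    (h : properSum N α = 0) : α = 0 := (properSum_nonpos_and hα).2 h

/-- The cones `tightDual T` lie in a common pointed cone. -/
theorem eq_zero_of_sum_eq_zero [Nontrivial N] {β : Finset N → Finset N → ℝ}
    (hβ : ∀ T, β T ∈ tightDual T) (h : ∑ T, β T = 0) (T : Finset N) : β T = 0 := by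
  refine eq_zero_of_properSum_eq_zero (hβ T) ?_
  refine (Finset.sum_eq_zero_iff_of_nonpos (s := Finset.univ)
    (f := fun T => properSum N (β T)) fun T _ => properSum_nonpos (hβ T)).1 ?_ T (Finset.mem_univ _)
  rw [← map_sum, h, map_zero]

theorem eq_zero_of_add_eq_zero [Nontrivial N] {T' : Finset N} (hα : α ∈ tightDual T)
    (hβ : β ∈ tightDual T') (h : α + β = 0) : α = 0 := by
  refine eq_zero_of_properSum_eq_zero hα ?_
  have := congrArg (properSum N) h
  rw [map_add, map_zero] at this
  linarith [properSum_nonpos hα, properSum_nonpos hβ]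

end tightDual

/-! ### The dual of the cone of exact games -/

theorem dotProduct_nonneg_of_mem_tightDual {T : Finset N} {α m : Finset N → ℝ}
    (hα : α ∈ tightDual T) (hm : m ∈ exactCone N) : 0 ≤ α ⬝ᵥ m := by
  obtain ⟨x, ⟨hxN, hx⟩, hxT⟩ := hm.2 T
  have h : α ⬝ᵥ m = ∑ S, α S * (m S - ∑ i ∈ S, x i) := by
    simp only [mul_sub, Finset.sum_sub_distrib, sum_mul_additive hα.1 x, sub_zero, dotProduct]
  rw [h]
  refine Finset.sum_nonneg fun S _ => ?_
  by_cases hS : S = ∅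
  · simp [hS, hm.1]
  by_cases hS' : S = Finset.univ
  · simp [hS', hxN]
  by_cases hST : S = T
  · simp [hST, hxT]
  · exact mul_nonneg_of_nonpos_of_nonpos (hα.2 S hS hS' hST) (by linarith [hx S])

theorem zero_mem_exactCone {N : Type*} [Fintype N] : (0 : Finset N → ℝ) ∈ exactCone N :=
  ⟨rfl, fun S => ⟨0, by simp [core], by simp⟩⟩

theorem smul_mem_exactCone {N : Type*} [Fintype N] {c : ℝ} (hc : 0 ≤ c) {m : Finset N → ℝ}
    (hm : m ∈ exactCone N) :
    c • m ∈ exactCone N := by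
  refine ⟨by simp [hm.1], fun S => ?_⟩
  obtain ⟨x, ⟨hxN, hx⟩, hxS⟩ := hm.2 S
  refine ⟨c • x, ⟨?_, fun T => ?_⟩, ?_⟩
  · simp [← Finset.mul_sum, hxN]
  · simpa [← Finset.mul_sum] using mul_le_mul_of_nonneg_left (hx T) hc
  · simp [← Finset.mul_sum, hxS]

/-- The dual of the cone of exact games is the sum of the cones `tightDual T`; more generally,
this describes the functionals that are non-negative on the exact games with
`⟨θ, m⟩ ≤ 0`. The exact games are the projection to `m` of the polyhedron of all pairs
`(m, (x T)_T)` in which `x T` is a core element of `m` that is tight at `T`, so that a single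
application of Farkas' lemma yields all the relations at once. -/
theorem exists_eq_sum_tightDual [Nonempty N] {γ θ : Finset N → ℝ} (hγ : ∑ S, γ S = 0)
    (hθ : ∑ S, θ S = 0) (h : ∀ m ∈ exactCone N, θ ⬝ᵥ m ≤ 0 → 0 ≤ γ ⬝ᵥ m) :
    ∃ (s : ℝ) (β : Finset N → Finset N → ℝ), 0 ≤ s ∧ (∀ T, β T ∈ tightDual T) ∧
      γ + s • θ = ∑ T, β T := by
  let W := (Finset N → ℝ) × (Finset N → N → ℝ)
  let gam (L : Finset N) : W →ₗ[ℝ] ℝ := LinearMap.proj L ∘ₗ LinearMap.fst ℝ _ _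
  let pay (T S : Finset N) : W →ₗ[ℝ] ℝ :=
    ∑ i ∈ S, LinearMap.proj i ∘ₗ LinearMap.proj T ∘ₗ LinearMap.snd ℝ _ _
  let lin (α : Finset N → ℝ) : W →ₗ[ℝ] ℝ := ∑ L, α L • gam L
  have hgam : ∀ L w, gam L w = w.1 L := fun L w => rfl
  have hpay : ∀ T S w, pay T S w = ∑ i ∈ S, w.2 T i := fun T S w => by
    simp only [pay, LinearMap.sum_apply]
    rfl
  have hlin : ∀ α w, lin α w = α ⬝ᵥ w.1 := fun α w => by
    simp [lin, hgam, dotProduct]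
  let a : (Finset N × Finset N) ⊕ (Finset N ⊕ (Finset N ⊕ Bool)) → W →ₗ[ℝ] ℝ :=
    Sum.elim (fun p => pay p.1 p.2 - gam p.2) <|
    Sum.elim (fun T => gam T - pay T T) <|
    Sum.elim (fun T => gam Finset.univ - pay T Finset.univ) <|
    fun b => cond b (gam ∅) (-lin θ)
  obtain ⟨c, hc, hf⟩ := farkas Finset.univ a (lin γ) fun w hw => by
    have hw1 : ∀ T S, w.1 S ≤ ∑ i ∈ S, w.2 T i := fun T S => by
      have := hw (Sum.inl (T, S)) (Finset.mem_univ _)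
      simp only [a, Sum.elim_inl, LinearMap.sub_apply, hpay, hgam] at this
      linarith
    have hw2 : ∀ T, ∑ i ∈ T, w.2 T i ≤ w.1 T := fun T => by
      have := hw (Sum.inr (Sum.inl T)) (Finset.mem_univ _)
      simp only [a, Sum.elim_inl, Sum.elim_inr, LinearMap.sub_apply, hpay, hgam] at this
      linarith
    have hw3 : ∀ T, ∑ i, w.2 T i ≤ w.1 Finset.univ := fun T => by
      have := hw (Sum.inr (Sum.inr (Sum.inl T))) (Finset.mem_univ _)
      simp only [a, Sum.elim_inl, Sum.elim_inr, LinearMap.sub_apply, hpay, hgam] at this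
      linarith
    have hw4 : 0 ≤ w.1 ∅ := by
      have := hw (Sum.inr (Sum.inr (Sum.inr true))) (Finset.mem_univ _)
      simpa only [a, Sum.elim_inl, Sum.elim_inr, cond_true, hgam] using this
    have hw5 : θ ⬝ᵥ w.1 ≤ 0 := by
      have := hw (Sum.inr (Sum.inr (Sum.inr false))) (Finset.mem_univ _)
      simpa only [a, Sum.elim_inl, Sum.elim_inr, cond_false, LinearMap.neg_apply, hlin,
        neg_nonneg] using this
    rw [hlin]
    refine h _ ⟨le_antisymm (by simpa using hw1 ∅ ∅) hw4, fun S => ⟨w.2 S, ⟨?_, hw1 S⟩, ?_⟩⟩ hw5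
    · exact le_antisymm (hw3 S) (hw1 S _)
    · exact le_antisymm (hw2 S) (hw1 S S)
  have hev : ∀ w : W, γ ⬝ᵥ w.1 =
      ∑ T, ∑ S, c (Sum.inl (T, S)) * (∑ i ∈ S, w.2 T i - w.1 S) +
      (∑ T, c (Sum.inr (Sum.inl T)) * (w.1 T - ∑ i ∈ T, w.2 T i) +
      (∑ T, c (Sum.inr (Sum.inr (Sum.inl T))) * (w.1 Finset.univ - ∑ i, w.2 T i) +
      (c (Sum.inr (Sum.inr (Sum.inr true))) * w.1 ∅ -
        c (Sum.inr (Sum.inr (Sum.inr false))) * (θ ⬝ᵥ w.1)))) := by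
    intro w
    have := LinearMap.congr_fun hf w
    rw [hlin] at this
    rw [this]
    simp only [Fintype.sum_sum_type, Fintype.sum_prod_type, Fintype.sum_bool, a, Sum.elim_inl,
      Sum.elim_inr, cond_true, cond_false, LinearMap.add_apply, LinearMap.sum_apply,
      LinearMap.smul_apply, LinearMap.sub_apply, LinearMap.neg_apply, hpay, hgam, hlin, smul_eq_mul]
    ring
  have hne : (Finset.univ : Finset N) ≠ ∅ := Finset.univ_nonempty.ne_empty
  -- The coefficients at `∅` are immaterial for games; they are chosen so as to make sums vanish.
  let b (T L : Finset N) : ℝ := -c (Sum.inl (T, L)) + (if L = T then c (Sum.inr (Sum.inl T)) else 0)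
    + (if L = Finset.univ then c (Sum.inr (Sum.inr (Sum.inl T))) else 0)
  let β (T : Finset N) : Finset N → ℝ := b T - Pi.single ∅ (∑ L, b T L)
  have hβ : ∀ T L, L ≠ ∅ → β T L = b T L := fun T L hL => by simp [β, hL]
  have hsum : ∀ T, ∑ L, β T L = 0 := fun T => by simp [β]
  refine ⟨c (Sum.inr (Sum.inr (Sum.inr false))), β, hc _, fun T => ⟨⟨hsum T, fun i => ?_⟩, ?_⟩, ?_⟩
  · have h1 := hev (0, Pi.single T (Pi.single i 1))
    have h2 : ∀ T' S : Finset N, ∑ j ∈ S, (Pi.single T (Pi.single i 1) : Finset N → N → ℝ) T' j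
        = if T' = T then chi S i else 0 := fun T' S => by
      by_cases hT : T' = T
      · subst hT; simp [chi]
      · simp [hT]
    have h3 : ∑ S, β T S * chi S i = ∑ S, b T S * chi S i := by
      refine Finset.sum_congr rfl fun S _ => ?_
      by_cases hS : S = ∅
      · simp [hS, chi]
      · rw [hβ T S hS]
    have h4 : ∀ S : Finset N, b T S * chi S i = -(c (Sum.inl (T, S)) * chi S i)
        + (if S = T then c (Sum.inr (Sum.inl T)) * chi S i else 0)
        + (if S = Finset.univ then c (Sum.inr (Sum.inr (Sum.inl T))) * chi S i else 0) := by
      intro S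
      simp only [b]
      split_ifs <;> ring
    rw [h3]
    simp only [h4, Finset.sum_add_distrib, Finset.sum_ite_eq', Finset.mem_univ, if_true,
      Finset.sum_neg_distrib]
    simp only [h2, dotProduct_zero, Pi.zero_apply, sub_zero, zero_sub, mul_zero, mul_ite, mul_neg,
      Finset.sum_neg_distrib, Finset.sum_ite_eq', Finset.mem_univ, if_true, add_zero,
      Finset.sum_ite_irrel, Finset.sum_const_zero] at h1
    linarith
  · intro L h1 h2 h3
    rw [hβ T L h1]
    simp [b, h2, h3, hc]
  · have hoff : ∀ L, L ≠ ∅ → γ L + c (Sum.inr (Sum.inr (Sum.inr false))) * θ L = ∑ T, β T L := by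
      intro L hL
      have h1 := hev (Pi.single L 1, 0)
      simp only [dotProduct_single, mul_one, Pi.zero_apply, Finset.sum_const_zero, zero_sub,
        sub_zero, Pi.single_apply, mul_neg, mul_ite, mul_zero, Finset.sum_neg_distrib,
        Finset.sum_ite_eq', Finset.mem_univ, if_true, hL.symm, if_false,
        Finset.sum_ite_irrel] at h1
      rw [Finset.sum_congr rfl fun T _ => hβ T L hL]
      simp only [b, Finset.sum_add_distrib, Finset.sum_neg_distrib, Finset.sum_ite_eq,
        Finset.mem_univ, if_true, Finset.sum_ite_irrel, Finset.sum_const_zero]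
      simp only [eq_comm (a := Finset.univ) (b := L)] at h1
      linarith
    funext L
    by_cases hL : L = ∅
    · subst hL
      have hz : ∑ L, (γ L + c (Sum.inr (Sum.inr (Sum.inr false))) * θ L - ∑ T, β T L) = 0 := by
        rw [Finset.sum_sub_distrib, Finset.sum_add_distrib, ← Finset.mul_sum, hγ, hθ,
          Finset.sum_comm, Finset.sum_eq_zero fun T _ => hsum T]
        ring
      rw [Finset.sum_eq_single ∅ (fun L _ hL => sub_eq_zero.2 (hoff L hL)) (by simp)] at hz
      simpa using sub_eq_zero.1 hz
    · simpa using hoff L hL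

/-- A vector with sum zero that annihilates all exact games is zero, so that the exact games
span the space of all games. -/
theorem eq_zero_of_forall_exactCone [Nontrivial N] {γ : Finset N → ℝ} (hγ : ∑ S, γ S = 0)
    (h : ∀ m ∈ exactCone N, γ ⬝ᵥ m = 0) : γ = 0 := by
  obtain ⟨s, β, -, hβ, h1⟩ := exists_eq_sum_tightDual hγ (θ := 0) (by simp)
    fun m hm _ => (h m hm).ge
  obtain ⟨s', β', -, hβ', h2⟩ := exists_eq_sum_tightDual (γ := -γ) (by simpa using hγ)
    (θ := 0) (by simp) fun m hm _ => by simp [h m hm]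
  have h3 : ∑ T, (β T + β' T) = 0 := by
    rw [Finset.sum_add_distrib, ← h1, ← h2]; simp
  have h4 := eq_zero_of_sum_eq_zero (fun T => add_mem_tightDual (hβ T) (hβ' T)) h3
  have h5 : ∀ T, β T = 0 := fun T => eq_zero_of_add_eq_zero (hβ T) (hβ' T) (h4 T)
  simpa [h5] using h1

/-! ### Facets of cones -/

section Facet

variable {ι : Type*} [Fintype ι] {C : Set (ι → ℝ)} {θ : ι → ℝ}

theorem isExposed_zeroFace (h0 : 0 ∈ C) (hθ : ∀ m ∈ C, 0 ≤ θ ⬝ᵥ m) :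
    IsExposed ℝ C (zeroFace C θ) := by
  classical
  intro _
  let l : (ι → ℝ) →ₗ[ℝ] ℝ := -(∑ i, θ i • LinearMap.proj i)
  have hl : ∀ x, l x = -(θ ⬝ᵥ x) := fun x => by simp [l, dotProduct]
  refine ⟨LinearMap.toContinuousLinearMap l, ?_⟩
  ext m
  simp only [zeroFace, Set.mem_ofPred_eq, LinearMap.coe_toContinuousLinearMap', hl]
  refine and_congr_right fun hm => ⟨fun h y hy => ?_, fun h => ?_⟩
  · rw [h]; linarith [hθ y hy]
  · have := h 0 h0
    rw [dotProduct_zero] at this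
    linarith [hθ m hm]

theorem affDim_eq_finrank_span {ι : Type*} {C : Set (ι → ℝ)} (h0 : 0 ∈ C) :
    affDim C = Module.finrank ℝ (Submodule.span ℝ C) := by
  have h : (fun x : ι → ℝ => x -ᵥ (0 : ι → ℝ)) = id := funext fun x => sub_zero x
  rw [affDim, vectorSpan_eq_span_vsub_set_right ℝ h0, h, Set.image_id]

/-- For a valid inequality of a cone, being facet-defining means that all linear functionals
vanishing on the face are proportional to the given one on the cone. -/
theorem isFacet_zeroFace_iff (h0 : 0 ∈ C) (hθ : ∀ m ∈ C, 0 ≤ θ ⬝ᵥ m)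
    {p : ι → ℝ} (hp : p ∈ C) (hpθ : θ ⬝ᵥ p ≠ 0) :
    IsFacet C (zeroFace C θ) ↔ ∀ γ : ι → ℝ, (∀ m ∈ zeroFace C θ, γ ⬝ᵥ m = 0) →
      ∃ k : ℝ, ∀ m ∈ C, γ ⬝ᵥ m = k * (θ ⬝ᵥ m) := by
  classical
  have h0F : (0 : ι → ℝ) ∈ zeroFace C θ := ⟨h0, dotProduct_zero _⟩
  let lin (γ : ι → ℝ) : (ι → ℝ) →ₗ[ℝ] ℝ := ∑ i, γ i • LinearMap.proj i
  have hlin : ∀ γ x, lin γ x = γ ⬝ᵥ x := fun γ x => by simp [lin, dotProduct]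
  have hsurj : ∀ l : (ι → ℝ) →ₗ[ℝ] ℝ, ∃ γ, l = lin γ := fun l => by
    refine ⟨fun i => l (Pi.single i 1), LinearMap.pi_ext' fun i => LinearMap.ext_ring ?_⟩
    simp [hlin]
  let V := Submodule.span ℝ C
  let U := Submodule.span ℝ (zeroFace C θ)
  let H := V ⊓ LinearMap.ker (lin θ)
  have hUH : U ≤ H := Submodule.span_le.2 fun m hm =>
    ⟨Submodule.subset_span hm.1, by simp [hlin, hm.2]⟩
  have hpV : p ∈ V := Submodule.subset_span hp
  have hdim : Module.finrank ℝ H + 1 = Module.finrank ℝ V := by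
    have h1 := LinearMap.finrank_range_add_finrank_ker ((lin θ).domRestrict V)
    have h2 : LinearMap.range ((lin θ).domRestrict V) = ⊤ :=
      LinearMap.range_eq_top.2 <| LinearMap.surjective fun h => hpθ <| by
        simpa [hlin] using LinearMap.congr_fun h ⟨p, hpV⟩
    have h3 : Module.finrank ℝ (LinearMap.ker ((lin θ).domRestrict V)) = Module.finrank ℝ H := by
      rw [LinearMap.ker_domRestrict]
      have h4 := Submodule.finrank_map_subtype_eq V ((LinearMap.ker (lin θ)).comap V.subtype)
      rw [Submodule.map_comap_subtype] at h4
      exact h4.symm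
    rw [h2, finrank_top, Module.finrank_self, h3] at h1
    omega
  have hiff : IsFacet C (zeroFace C θ) ↔ U = H := by
    rw [IsFacet, affDim_eq_finrank_span h0, affDim_eq_finrank_span h0F]
    constructor
    · rintro ⟨-, -, h⟩
      refine Submodule.eq_of_le_of_finrank_eq hUH ?_
      change Module.finrank ℝ U + 1 = Module.finrank ℝ V at h
      omega
    · intro h
      refine ⟨isExposed_zeroFace h0 hθ, ⟨0, h0F⟩, ?_⟩
      change Module.finrank ℝ U + 1 = Module.finrank ℝ V
      rw [h, hdim]
  rw [hiff]
  constructor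
  · intro hU γ hγ
    refine ⟨γ ⬝ᵥ p / θ ⬝ᵥ p, fun m hm => ?_⟩
    have hmH : m - (θ ⬝ᵥ m / θ ⬝ᵥ p) • p ∈ H := by
      refine ⟨sub_mem (Submodule.subset_span hm) (Submodule.smul_mem _ _ hpV), ?_⟩
      simp [hlin, dotProduct_sub, hpθ]
    rw [← hU] at hmH
    have hz : U ≤ LinearMap.ker (lin γ) := Submodule.span_le.2 fun m hm => by
      simpa [hlin] using hγ m hm
    have := hz hmH
    rw [LinearMap.mem_ker, hlin, dotProduct_sub, dotProduct_smul, smul_eq_mul] at this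
    rw [sub_eq_zero.1 this]
    ring
  · intro h
    refine le_antisymm hUH fun x hx => ?_
    by_contra hxU
    obtain ⟨l, hlx, hl⟩ := Submodule.exists_le_ker_of_notMem hxU
    obtain ⟨γ, rfl⟩ := hsurj l
    obtain ⟨k, hk⟩ := h γ fun m hm => by
      simpa [hlin] using hl (Submodule.subset_span hm)
    have hV : V ≤ LinearMap.ker (lin γ - k • lin θ) := Submodule.span_le.2 fun m hm => by
      simp [hlin, hk m hm]
    have h1 := hV hx.1
    have h2 : lin θ x = 0 := hx.2
    rw [LinearMap.mem_ker, LinearMap.sub_apply, LinearMap.smul_apply, h2, smul_zero,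
      sub_zero] at h1
    exact hlx h1

end Facet

/-! ### Semi-balanced systems and linear relations -/

section

variable {N : Type*} {𝒮 : Finset (Finset N)} {c : Finset N → ℝ} {r : ℝ} {T : Finset N}

theorem IsSemiConic.exists_forall_nonneg (h : IsSemiConic 𝒮 c) :
    ∃ T, (∀ S ∈ 𝒮, S ≠ T → 0 ≤ c S) ∧ ((∃ S ∈ 𝒮, c S < 0) → T ∈ 𝒮 ∧ c T < 0) := by
  by_cases hT : ∃ T ∈ 𝒮, c T < 0
  · obtain ⟨T, hT, hcT⟩ := hT
    refine ⟨T, fun S hS hST => ?_, fun _ => ⟨hT, hcT⟩⟩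
    by_contra! hcS
    exact hST (h ⟨hS, hcS⟩ ⟨hT, hcT⟩)
  · push Not at hT
    exact ⟨∅, fun S hS _ => hT S hS, fun ⟨S, hS, hcS⟩ => absurd hcS (not_lt.2 (hT S hS))⟩

theorem IsNontrivial.ne_empty [Fintype N] (h : IsNontrivial 𝒮) {S : Finset N} (hS : S ∈ 𝒮) : S ≠ ∅ := by
  rintro rfl; exact h.2.1 hS

theorem IsNontrivial.ne_univ [Fintype N] (h : IsNontrivial 𝒮) {S : Finset N} (hS : S ∈ 𝒮) :
    S ≠ Finset.univ := by
  rintro rfl; exact h.2.2 hS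

theorem yieldsConst_iff [DecidableEq N] :
    YieldsConst 𝒮 c r ↔ ∀ i, ∑ S ∈ 𝒮, c S * chi S i = r := by
  simp [YieldsConst, funext_iff, Finset.sum_apply]

theorem chi_nonneg [DecidableEq N] (S : Finset N) (i : N) : 0 ≤ chi S i := by
  simp only [chi]; split_ifs <;> norm_num

theorem isSemiConic_of_forall_nonneg (h : ∀ S ∈ 𝒮, S ≠ T → 0 ≤ c S) : IsSemiConic 𝒮 c := by
  have : ∀ S, S ∈ 𝒮 → c S < 0 → S = T := fun S hS hcS => by
    by_contra hST
    exact absurd hcS (not_lt.2 (h S hS hST))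
  rintro S ⟨hS, hcS⟩ S' ⟨hS', hcS'⟩
  rw [this S hS hcS, this S' hS' hcS']

end


/-- The linear relation expressing that the combination of the incidence vectors of the members
of `𝒮` with coefficients `c` is the constant vector `[r, …, r]`. The coefficients need not be
affine; the one at `∅` makes the sum of all coefficients vanish. -/
def relVec (𝒮 : Finset (Finset N)) (c : Finset N → ℝ) (r : ℝ) : Finset N → ℝ :=
  Pi.single Finset.univ r + Pi.single ∅ (∑ S ∈ 𝒮, c S - r) - fun L => if L ∈ 𝒮 then c L else 0

section

variable {𝒮 : Finset (Finset N)} {c : Finset N → ℝ} {r : ℝ} {α θ : Finset N → ℝ} {T : Finset N}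

theorem relVec_mem_nullSpace (h : YieldsConst 𝒮 c r) : relVec 𝒮 c r ∈ nullSpace N := by
  refine ⟨?_, fun i => ?_⟩
  · simp [relVec, Finset.sum_add_distrib, Finset.sum_sub_distrib]
  · simp only [relVec, Pi.sub_apply, Pi.add_apply, Pi.single_apply, sub_mul, add_mul, ite_mul,
      zero_mul, Finset.sum_add_distrib, Finset.sum_sub_distrib, Finset.sum_ite_eq',
      Finset.mem_univ, if_true, Finset.sum_ite_mem, Finset.univ_inter, yieldsConst_iff.1 h i]
    simp [chi]

theorem relVec_apply {L : Finset N} (h1 : L ≠ ∅) (h2 : L ≠ Finset.univ) :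
    relVec 𝒮 c r L = -if L ∈ 𝒮 then c L else 0 := by
  simp [relVec, h1, h2]

theorem relVec_apply_of_mem (h : IsNontrivial 𝒮) {L : Finset N} (hL : L ∈ 𝒮) :
    relVec 𝒮 c r L = -c L := by
  rw [relVec_apply (h.ne_empty hL) (h.ne_univ hL), if_pos hL]

theorem relVec_mem_tightDual (h : YieldsConst 𝒮 c r) (hc : ∀ S ∈ 𝒮, S ≠ T → 0 ≤ c S) :
    relVec 𝒮 c r ∈ tightDual T := by
  refine ⟨relVec_mem_nullSpace h, fun L h1 h2 h3 => ?_⟩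
  rw [relVec_apply h1 h2]
  split_ifs with hL
  · simpa using hc L hL h3
  · simp

theorem properSum_eq_sum (h𝒮 : IsNontrivial 𝒮)
    (h : ∀ L, L ≠ ∅ → L ≠ Finset.univ → L ∉ 𝒮 → α L = 0) : properSum N α = ∑ S ∈ 𝒮, α S := by
  rw [properSum_apply]
  refine (Finset.sum_subset (fun S hS => ?_) fun L hL hL' => ?_).symm
  · simp [h𝒮.ne_empty hS, h𝒮.ne_univ hS]
  · simp only [Finset.mem_sdiff, Finset.mem_univ, true_and, Finset.mem_insert,
      Finset.mem_singleton, not_or] at hL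
    exact h L hL.1 hL.2 hL'

theorem properSum_relVec (h𝒮 : IsNontrivial 𝒮) : properSum N (relVec 𝒮 c r) = -∑ S ∈ 𝒮, c S := by
  rw [properSum_eq_sum h𝒮 fun L h1 h2 h3 => by rw [relVec_apply h1 h2, if_neg h3, neg_zero],
    ← Finset.sum_neg_distrib]
  exact Finset.sum_congr rfl fun S hS => relVec_apply_of_mem h𝒮 hS

theorem coeffVec_eq_relVec [Nonempty N] (h𝒮 : IsNontrivial 𝒮) (hc : ∑ S ∈ 𝒮, c S = 1) :
    coeffVec 𝒮 c r = relVec 𝒮 c r := by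
  have hne : (Finset.univ : Finset N) ≠ ∅ := Finset.univ_nonempty.ne_empty
  funext L
  by_cases h1 : L = Finset.univ
  · subst h1; simp [coeffVec, relVec, h𝒮.2.2, hne]
  by_cases h2 : L = ∅
  · subst h2; simp [coeffVec, relVec, h𝒮.2.1, hne.symm, hc]
  · rw [relVec_apply h2 h1]
    simp only [coeffVec, h1, h2, if_false]
    split_ifs <;> simp

theorem yieldsConst_of_mem_nullSpace (h𝒮 : IsNontrivial 𝒮) (hα : α ∈ nullSpace N)
    (h : ∀ L, L ≠ ∅ → L ≠ Finset.univ → L ∉ 𝒮 → α L = 0) :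
    YieldsConst 𝒮 (-α) (α Finset.univ) := by
  refine yieldsConst_iff.2 fun i => ?_
  have h1 := hα.2 i
  rw [← Finset.sum_subset (Finset.subset_univ (insert Finset.univ 𝒮)), Finset.sum_insert h𝒮.2.2]
    at h1
  · simp only [Pi.neg_apply, neg_mul, Finset.sum_neg_distrib]
    simp only [chi, Finset.mem_univ, if_true, mul_one] at h1 ⊢
    linarith
  · intro L _ hL
    simp only [Finset.mem_insert, not_or] at hL
    by_cases hL' : L = ∅
    · simp [hL', chi]
    · rw [h L hL' hL.1 hL.2, zero_mul]

theorem eq_zero_of_proper_eq_zero [Nontrivial N] (hα : α ∈ nullSpace N)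
    (h : ∀ L, L ≠ ∅ → L ≠ Finset.univ → α L = 0) : α = 0 := by
  refine eq_zero_of_properSum_eq_zero (T := ∅) ⟨hα, fun L h1 h2 _ => (h L h1 h2).le⟩ ?_
  rw [properSum_apply]
  refine Finset.sum_eq_zero fun L hL => ?_
  simp only [Finset.mem_sdiff, Finset.mem_univ, true_and, Finset.mem_insert,
    Finset.mem_singleton, not_or] at hL
  exact h L hL.1 hL.2

theorem isBalanced_of_pos (h𝒮 : IsNontrivial 𝒮) (hc : ∀ S ∈ 𝒮, 0 < c S)
    (h : YieldsConst 𝒮 c r) : IsBalanced 𝒮 := by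
  have h1 := yieldsConst_iff.1 h
  have hr : 0 < r := by
    obtain ⟨S, hS⟩ := h𝒮.1
    obtain ⟨i, hi⟩ := Finset.nonempty_iff_ne_empty.2 (h𝒮.ne_empty hS)
    rw [← h1 i]
    refine Finset.sum_pos' (fun S hS => mul_nonneg (hc S hS).le (chi_nonneg S i)) ⟨S, hS, ?_⟩
    simpa [chi, hi] using hc S hS
  refine ⟨h𝒮, fun S => c S / r, fun S hS => div_pos (hc S hS) hr, ?_⟩
  funext i
  have h2 : ∀ S, c S / r * chi S i = c S * chi S i / r := fun S => by ring
  simp only [Finset.sum_apply, Pi.smul_apply, smul_eq_mul, h2, ← Finset.sum_div, h1 i]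
  simp [chi, hr.ne']

/-- The combinations of a min-semi-balanced system are unique up to a factor: otherwise one could
move from the given one, along a line of combinations, to the first point at which a coefficient
vanishes; there no coefficient has changed sign, so that a smaller system would be
semi-balanced. -/
theorem IsMinSemiBalanced.exists_eq_mul (h : IsMinSemiBalanced 𝒮) (hc0 : ∀ S ∈ 𝒮, c S ≠ 0)
    (hc : IsSemiConic 𝒮 c) (hcr : YieldsConst 𝒮 c r) {d : Finset N → ℝ} {r' : ℝ}
    (hd : YieldsConst 𝒮 d r') : ∃ k : ℝ, ∀ S ∈ 𝒮, d S = k * c S := by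
  obtain ⟨L, hL, hmax⟩ := Finset.exists_max_image 𝒮 (fun S => |d S / c S|) h.1.1.1
  by_cases hq : d L / c L = 0
  · refine ⟨0, fun S hS => ?_⟩
    have := hmax S hS
    rw [hq, abs_zero, abs_nonpos_iff, div_eq_zero_iff] at this
    rw [zero_mul]
    exact this.resolve_right (hc0 S hS)
  let e (S : Finset N) : ℝ := c S - d S / (d L / c L)
  have he : ∀ S ∈ 𝒮, e S = c S * (1 - d S / c S / (d L / c L)) := fun S hS => by
    have := hc0 S hS
    simp only [e]
    field_simp
  have hfac : ∀ S ∈ 𝒮, 0 ≤ 1 - d S / c S / (d L / c L) := fun S hS => by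
    have h1 : |d S / c S / (d L / c L)| ≤ 1 := by
      rw [abs_div]
      exact div_le_one_of_le₀ (hmax S hS) (abs_nonneg _)
    linarith [le_abs_self (d S / c S / (d L / c L))]
  have heL : e L = 0 := by rw [he L hL, div_self hq, sub_self, mul_zero]
  by_cases hne : ∃ S ∈ 𝒮, e S ≠ 0
  · exfalso
    have hsemi : IsSemiBalanced (𝒮.filter (e · ≠ 0)) := by
      obtain ⟨S, hS, heS⟩ := hne
      refine ⟨⟨⟨S, by simp [hS, heS]⟩, by simp [h.1.1.2.1], by simp [h.1.1.2.2]⟩, e,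
        r - r' / (d L / c L), by simp, ?_, ?_⟩
      · have : ∀ S ∈ 𝒮, e S < 0 → c S < 0 := fun S hS hlt => by
          by_contra! hcS
          rw [he S hS] at hlt
          exact absurd hlt (not_lt.2 (mul_nonneg hcS (hfac S hS)))
        rintro S ⟨hS, heS⟩ S' ⟨hS', heS'⟩
        rw [Finset.mem_filter] at hS hS'
        exact hc ⟨hS.1, this S hS.1 heS⟩ ⟨hS'.1, this S' hS'.1 heS'⟩
      · refine yieldsConst_iff.2 fun i => ?_
        rw [Finset.sum_filter_of_ne fun S _ hS => left_ne_zero_of_mul hS,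
          ← yieldsConst_iff.1 hcr i, ← yieldsConst_iff.1 hd i, Finset.sum_div,
          ← Finset.sum_sub_distrib]
        exact Finset.sum_congr rfl fun S _ => by simp only [e]; ring
    have := h.2 hsemi (Finset.filter_subset _ _) hL
    simp [heL] at this
  · push Not at hne
    refine ⟨d L / c L, fun S hS => ?_⟩
    have := sub_eq_zero.1 (hne S hS)
    rw [eq_div_iff hq] at this
    linarith

theorem IsMinSemiBalanced.exists_eq_smul [Nontrivial N] (h : IsMinSemiBalanced 𝒮)
    (hθ : θ ∈ tightDual T) (hθ0 : ∀ L ∈ 𝒮, θ L ≠ 0)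
    (hθ1 : ∀ L, L ≠ ∅ → L ≠ Finset.univ → L ∉ 𝒮 → θ L = 0) (hα : α ∈ nullSpace N)
    (hα1 : ∀ L, L ≠ ∅ → L ≠ Finset.univ → L ∉ 𝒮 → α L = 0) : ∃ k : ℝ, α = k • θ := by
  obtain ⟨k, hk⟩ := h.exists_eq_mul (c := -θ) (d := -α) (by simpa using hθ0)
    (isSemiConic_of_forall_nonneg (T := T) fun S hS hST => by
      simpa using hθ.2 S (h.1.1.ne_empty hS) (h.1.1.ne_univ hS) hST)
    (yieldsConst_of_mem_nullSpace h.1.1 hθ.1 hθ1) (yieldsConst_of_mem_nullSpace h.1.1 hα hα1)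
  refine ⟨k, sub_eq_zero.1 (eq_zero_of_proper_eq_zero
    (sub_mem hα (Submodule.smul_mem _ k hθ.1)) fun L h1 h2 => ?_)⟩
  by_cases hL : L ∈ 𝒮
  · have := hk L hL
    simp only [Pi.neg_apply, mul_neg, neg_inj] at this
    simp [this]
  · simp [hα1 L h1 h2 hL, hθ1 L h1 h2 hL]

/-- For a min-semi-balanced system `𝒮` the vector `θ_𝒮` exists, lies in one of the cones
`tightDual T`, and its support among the non-empty proper coalitions is `𝒮`. -/
theorem IsMinSemiBalanced.exists_isThetaOf [Nontrivial N] (h : IsMinSemiBalanced 𝒮) :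
    ∃ (θ : Finset N → ℝ) (T : Finset N), IsThetaOf θ 𝒮 ∧ θ ∈ tightDual T ∧
      (∀ L ∈ 𝒮, θ L ≠ 0) ∧ (∀ L, L ≠ ∅ → L ≠ Finset.univ → L ∉ 𝒮 → θ L = 0) ∧
      properSum N θ = -1 := by
  obtain ⟨h𝒮, c, r, hc0, hc, hcr⟩ := h.1
  obtain ⟨T, hT, -⟩ := hc.exists_forall_nonneg
  have hmem := relVec_mem_tightDual hcr hT
  have hκ : 0 < ∑ S ∈ 𝒮, c S := by
    have h1 := properSum_nonpos hmem
    rw [properSum_relVec h𝒮, neg_nonpos] at h1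
    refine lt_of_le_of_ne h1 fun h2 => ?_
    have h3 := eq_zero_of_properSum_eq_zero hmem (by rw [properSum_relVec h𝒮, ← h2, neg_zero])
    obtain ⟨S, hS⟩ := h𝒮.1
    have h4 := congrFun h3 S
    rw [relVec_apply_of_mem h𝒮 hS] at h4
    exact hc0 S hS (by simpa using h4)
  set κ := ∑ S ∈ 𝒮, c S
  have hc1 : ∑ S ∈ 𝒮, c S / κ = 1 := by rw [← Finset.sum_div, div_self hκ.ne']
  have hcr1 : YieldsConst 𝒮 (fun S => c S / κ) (r / κ) := yieldsConst_iff.2 fun i => by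
    rw [← yieldsConst_iff.1 hcr i, Finset.sum_div]
    exact Finset.sum_congr rfl fun S _ => by ring
  have hT1 : ∀ S ∈ 𝒮, S ≠ T → 0 ≤ c S / κ := fun S hS hST => div_nonneg (hT S hS hST) hκ.le
  have hc01 : ∀ S ∈ 𝒮, c S / κ ≠ 0 := fun S hS => div_ne_zero (hc0 S hS) hκ.ne'
  refine ⟨relVec 𝒮 (fun S => c S / κ) (r / κ), T, ?_, relVec_mem_tightDual hcr1 hT1,
    fun L hL => ?_, fun L h1 h2 h3 => ?_, ?_⟩
  · refine Set.eq_singleton_iff_unique_mem.2 ⟨⟨_, _, hc1, isSemiConic_of_forall_nonneg hT1, hcr1,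
      (coeffVec_eq_relVec h𝒮 hc1).symm⟩, ?_⟩
    rintro _ ⟨d, r', hd1, -, hdr, rfl⟩
    obtain ⟨k, hk⟩ := h.exists_eq_mul hc01 (isSemiConic_of_forall_nonneg hT1) hcr1 hdr
    rw [Finset.sum_congr rfl hk, ← Finset.mul_sum, hc1, mul_one] at hd1
    subst hd1
    simp only [one_mul] at hk
    obtain ⟨i⟩ : Nonempty N := inferInstance
    have hr : r' = r / κ := by
      rw [← yieldsConst_iff.1 hdr i, ← yieldsConst_iff.1 hcr1 i]
      exact Finset.sum_congr rfl fun S hS => by rw [hk S hS]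
    rw [← coeffVec_eq_relVec h𝒮 hc1, hr]
    funext L
    simp only [coeffVec]
    split_ifs with h1 h2 h3
    · rfl
    · rfl
    · rw [hk L h3]
    · rfl
  · rw [relVec_apply_of_mem h𝒮 hL, neg_ne_zero]
    exact hc01 L hL
  · rw [relVec_apply h1 h2, if_neg h3, neg_zero]
  · rw [properSum_relVec h𝒮, hc1]

theorem IsPurelyMinSemiBalanced.eq_zero_of_nonpos [Nontrivial N] (h : IsPurelyMinSemiBalanced 𝒮)
    (hα : α ∈ nullSpace N) (hα1 : ∀ L, L ≠ ∅ → L ≠ Finset.univ → L ∉ 𝒮 → α L = 0)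
    (hα0 : ∀ L ∈ 𝒮, α L ≤ 0) : α = 0 := by
  obtain ⟨θ, T, -, hθ, hθ0, hθ1, -⟩ := h.1.exists_isThetaOf
  obtain ⟨k, hk⟩ := h.1.exists_eq_smul hθ hθ0 hθ1 hα hα1
  by_contra hne
  have hk0 : k ≠ 0 := by rintro rfl; exact hne (by simpa using hk)
  refine h.2 (isBalanced_of_pos h.1.1.1 (c := -α) (fun S hS => ?_)
    (yieldsConst_of_mem_nullSpace h.1.1.1 hα hα1))
  have : α S ≠ 0 := by rw [hk]; exact mul_ne_zero hk0 (hθ0 S hS)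
  simpa using lt_of_le_of_ne (hα0 S hS) this

/-- If a sum of elements of the cones `tightDual T` is supported on an indecomposable system `𝒮`,
then so are all summands. A coalition `T ∉ 𝒮` at which `β T` is positive is eliminated by
distributing `β T` among the other summands so as to make their coefficients at `T` vanish.
By induction the new summands are supported on `𝒮`. Those of index outside `𝒮` then vanish since
`𝒮` has no balanced subsystem, hence one of index in `𝒮` absorbs a positive multiple of `β T`,
and therefore `β T` is supported on `𝒮 ∪ {T}`, that is, `T` is exceptional. -/
theorem IsIndecomposable.apply_eq_zero_of_sum [Nontrivial N] (h : IsIndecomposable 𝒮)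
    {β : Finset N → Finset N → ℝ} (hβ : ∀ T, β T ∈ tightDual T)
    (hsum : ∀ L, L ≠ ∅ → L ≠ Finset.univ → L ∉ 𝒮 → ∑ T, β T L = 0) :
    ∀ T L, L ≠ ∅ → L ≠ Finset.univ → L ∉ 𝒮 → β T L = 0 := by
  induction hn : (Finset.univ.filter fun T => T ∉ 𝒮 ∧ T ≠ ∅ ∧ T ≠ Finset.univ ∧ 0 < β T T).card
    using Nat.strong_induction_on generalizing β with
  | _ n ih =>
  subst hn
  by_cases hJ : ∃ T, T ∉ 𝒮 ∧ T ≠ ∅ ∧ T ≠ Finset.univ ∧ 0 < β T T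
  · exfalso
    obtain ⟨T, hT𝒮, hT0, hT1, hp⟩ := hJ
    let w (T' : Finset N) : ℝ := -β T' T / β T T
    let β' (T' : Finset N) : Finset N → ℝ := if T' = T then 0 else β T' + w T' • β T
    have hβT : β' T = 0 := by simp [β']
    have hβ' : ∀ T', T' ≠ T → β' T' = β T' + w T' • β T := fun T' hT' => by simp [β', hT']
    have hw : ∀ T', T' ≠ T → 0 ≤ w T' := fun T' hT' =>
      div_nonneg (neg_nonneg.2 ((hβ T').2 T hT0 hT1 hT'.symm)) hp.le
    have hβmem : ∀ T', β' T' ∈ tightDual T' := fun T' => by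
      by_cases hT' : T' = T
      · rw [hT', hβT]; exact zero_mem_tightDual
      · have hwT := hw T' hT'
        have hz : β T' T + w T' * β T T = 0 := by
          simp only [w]; field_simp; ring
        rw [hβ' T' hT']
        refine ⟨add_mem (hβ T').1 (Submodule.smul_mem _ _ (hβ T).1), fun L h1 h2 h3 => ?_⟩
        by_cases hL : L = T
        · rw [hL]; exact hz.le
        · exact add_nonpos ((hβ T').2 L h1 h2 h3)
            (mul_nonpos_of_nonneg_of_nonpos hwT ((hβ T).2 L h1 h2 hL))
    have hwsum : ∑ T' ∈ Finset.univ.erase T, w T' = 1 := by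
      have h1 := hsum T hT0 hT1 hT𝒮
      rw [← Finset.add_sum_erase _ _ (Finset.mem_univ T)] at h1
      simp only [w]
      rw [← Finset.sum_div, Finset.sum_neg_distrib, div_eq_one_iff_eq hp.ne']
      linarith
    have hsum' : ∀ L, ∑ T', β' T' L = ∑ T', β T' L := fun L => by
      rw [← Finset.add_sum_erase _ _ (Finset.mem_univ T),
        ← Finset.add_sum_erase _ _ (Finset.mem_univ T), hβT,
        Finset.sum_congr rfl fun T' hT' => by rw [hβ' T' (Finset.ne_of_mem_erase hT')]]
      simp [Finset.sum_add_distrib, ← Finset.sum_mul, hwsum, add_comm]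
    have hzero := ih _ (Finset.card_lt_card (Finset.ssubset_iff_of_subset (fun T' => ?_) |>.2
      ⟨T, by simp [hT𝒮, hT0, hT1, hp], by simp [hβT]⟩)) hβmem
      (fun L h1 h2 h3 => (hsum' L).trans (hsum L h1 h2 h3)) rfl
    swap
    · simp only [Finset.mem_filter, Finset.mem_univ, true_and]
      rintro ⟨h1, h2, h3, h4⟩
      have hT' : T' ≠ T := by rintro rfl; simp [hβT] at h4
      refine ⟨h1, h2, h3, ?_⟩
      rw [hβ' T' hT', Pi.add_apply, Pi.smul_apply, smul_eq_mul] at h4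
      linarith [mul_nonpos_of_nonneg_of_nonpos (hw T' hT') ((hβ T).2 T' h2 h3 hT')]
    have hw0 : ∀ T', T' ∉ 𝒮 → T' ≠ T → w T' = 0 := fun T' h1 h2 => by
      have h3 : β' T' = 0 := h.1.eq_zero_of_nonpos (hβmem T').1 (hzero T') fun L hL =>
        (hβmem T').2 L (h.1.1.1.1.ne_empty hL) (h.1.1.1.1.ne_univ hL) (by rintro rfl; exact h1 hL)
      rw [hβ' T' h2, add_comm] at h3
      have h4 := congrFun (eq_zero_of_add_eq_zero (smul_mem_tightDual (hw T' h2) (hβ T)) (hβ T') h3) T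
      exact (mul_eq_zero.1 h4).resolve_right hp.ne'
    obtain ⟨T', hT', hwT'⟩ := Finset.exists_ne_zero_of_sum_ne_zero (hwsum.trans_ne one_ne_zero)
    have hT'T := Finset.ne_of_mem_erase hT'
    have hT'𝒮 : T' ∈ 𝒮 := by
      by_contra h1
      exact hwT' (hw0 T' h1 hT'T)
    have hsupp : ∀ L, L ≠ ∅ → L ≠ Finset.univ → L ∉ insert T 𝒮 → β T L = 0 := by
      intro L h1 h2 h3
      rw [Finset.mem_insert, not_or] at h3
      have h4 := hzero T' L h1 h2 h3.2
      rw [hβ' T' hT'T, Pi.add_apply, Pi.smul_apply, smul_eq_mul] at h4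
      have h5 := (hβ T').2 L h1 h2 (by rintro rfl; exact h3.2 hT'𝒮)
      have h6 := (hβ T).2 L h1 h2 h3.1
      have h7 := mul_nonpos_of_nonneg_of_nonpos (hw T' hT'T) h6
      have h8 : w T' * β T L = 0 := by linarith
      exact (mul_eq_zero.1 h8).resolve_left hwT'
    have hnt : IsNontrivial (insert T 𝒮) :=
      ⟨Finset.insert_nonempty _ _, by simp [hT0.symm, h.1.1.1.1.2.1],
        by simp [hT1.symm, h.1.1.1.1.2.2]⟩
    refine h.2 ⟨T, hT𝒮, hT0, hT1, hnt, Finset.mem_insert_self _ _, -β T, β T Finset.univ,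
      by simpa using hp, fun S hS hST => ?_, yieldsConst_of_mem_nullSpace hnt (hβ T).1 hsupp⟩
    simpa using (hβ T).2 S (hnt.ne_empty hS) (hnt.ne_univ hS) hST
  · push Not at hJ
    intro T L h1 h2 h3
    refine (Finset.sum_eq_zero_iff_of_nonpos fun T' _ => ?_).1 (hsum L h1 h2 h3) T
      (Finset.mem_univ _)
    by_cases hT' : T' = L
    · subst hT'; exact hJ T' h3 (Finset.nonempty_iff_ne_empty.2 h1) h2
    · exact (hβ T').2 L h1 h2 (Ne.symm hT')

end

/-! ### Facets of the cone of exact games -/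

theorem IsMinSemiBalanced.of_isThetaOf [Nontrivial N] {𝒮 : Finset (Finset N)}
    {θ : Finset N → ℝ} (h : IsMinSemiBalanced 𝒮) (hθ : IsThetaOf θ 𝒮) :
    ∃ T, θ ∈ tightDual T ∧ (∀ L ∈ 𝒮, θ L ≠ 0) ∧
      (∀ L, L ≠ ∅ → L ≠ Finset.univ → L ∉ 𝒮 → θ L = 0) ∧ properSum N θ = -1 := by
  obtain ⟨θ', T, hθ', h1⟩ := h.exists_isThetaOf
  obtain rfl : θ = θ' := Set.singleton_injective (hθ.symm.trans hθ')
  exact ⟨T, h1⟩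

theorem exists_exactCone_dotProduct_ne_zero [Nontrivial N] {θ : Finset N → ℝ}
    (hsum : ∑ S, θ S = 0) (hθ : properSum N θ = -1) : ∃ p ∈ exactCone N, θ ⬝ᵥ p ≠ 0 := by
  by_contra! h
  have := eq_zero_of_forall_exactCone hsum h
  simp [this] at hθ

/-- Subtracting a multiple of the coordinate functional at `∅`, which vanishes on games. -/
theorem exists_sum_eq_zero_dotProduct_eq (γ : Finset N → ℝ) :
    ∃ γ' : Finset N → ℝ, ∑ S, γ' S = 0 ∧ ∀ m ∈ exactCone N, γ' ⬝ᵥ m = γ ⬝ᵥ m :=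
  ⟨γ - Pi.single ∅ (∑ S, γ S), by simp, fun m hm => by simp [sub_dotProduct, hm.1]⟩

/-- The linear functionals vanishing on the face of an indecomposable system `𝒮` are combinations
of `θ_𝒮` and of relations that add up to a multiple of `θ_𝒮` with further relations; all of these
are supported on `𝒮` and hence are multiples of `θ_𝒮`. -/
theorem IsIndecomposable.isFacetDefining [Nontrivial N] {𝒮 : Finset (Finset N)}
    {θ : Finset N → ℝ} (h : IsIndecomposable 𝒮) (hθ : IsThetaOf θ 𝒮) :
    IsFacetDefining (exactCone N) θ := by
  obtain ⟨T, hθT, hθ0, hθ1, hθs⟩ := h.1.1.of_isThetaOf hθ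
  have hval : ∀ m ∈ exactCone N, 0 ≤ θ ⬝ᵥ m :=
    fun m hm => dotProduct_nonneg_of_mem_tightDual hθT hm
  obtain ⟨p, hp, hpθ⟩ := exists_exactCone_dotProduct_ne_zero hθT.1.1 hθs
  refine ⟨hval, (isFacet_zeroFace_iff zero_mem_exactCone hval hp hpθ).2 fun γ hγ => ?_⟩
  obtain ⟨γ', hγs, hγ'⟩ := exists_sum_eq_zero_dotProduct_eq γ
  have hz : ∀ m ∈ exactCone N, θ ⬝ᵥ m ≤ 0 → γ' ⬝ᵥ m = 0 := fun m hm hle => by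
    rw [hγ' m hm]
    exact hγ m ⟨hm, le_antisymm hle (hval m hm)⟩
  obtain ⟨s, β, -, hβ, hs⟩ := exists_eq_sum_tightDual hγs hθT.1.1 fun m hm hle => (hz m hm hle).ge
  obtain ⟨s', β', -, hβ', hs'⟩ := exists_eq_sum_tightDual (γ := -γ') (by simpa using hγs)
    hθT.1.1 fun m hm hle => by simp [hz m hm hle]
  have hsum : ∑ T, (β T + β' T) = (s + s') • θ := by
    rw [Finset.sum_add_distrib, ← hs, ← hs', add_smul]; abel
  have hmem : ∀ T, β T + β' T ∈ tightDual T := fun T => add_mem_tightDual (hβ T) (hβ' T)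
  have hzero := h.apply_eq_zero_of_sum hmem fun L h1 h2 h3 => by
    have := congrFun hsum L
    rw [Finset.sum_apply] at this
    rw [this, Pi.smul_apply, hθ1 L h1 h2 h3, smul_zero]
  have hβ0 : ∀ T L, L ≠ ∅ → L ≠ Finset.univ → L ∉ 𝒮 → β T L = 0 := by
    intro T L h1 h2 h3
    by_cases hT : T ∈ 𝒮
    · have hLT : L ≠ T := by rintro rfl; exact h3 hT
      have h4 := hzero T L h1 h2 h3
      rw [Pi.add_apply] at h4
      linarith [(hβ T).2 L h1 h2 hLT, (hβ' T).2 L h1 h2 hLT]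
    · have h4 := h.1.eq_zero_of_nonpos (hmem T).1 (hzero T) fun L hL =>
        (hmem T).2 L (h.1.1.1.1.ne_empty hL) (h.1.1.1.1.ne_univ hL) (by rintro rfl; exact hT hL)
      simp [eq_zero_of_add_eq_zero (hβ T) (hβ' T) h4]
  have hex : ∀ T, ∃ k : ℝ, β T = k • θ := fun T =>
    h.1.1.exists_eq_smul hθT hθ0 hθ1 (hβ T).1 (hβ0 T)
  choose k hk using hex
  refine ⟨∑ T, k T - s, fun m hm => ?_⟩
  have hγθ : γ' = (∑ T, k T - s) • θ := by
    rw [sub_smul, Finset.sum_smul, ← Finset.sum_congr rfl fun T _ => hk T, ← hs,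
      add_sub_cancel_right]
  rw [← hγ' m hm, hγθ, smul_dotProduct, smul_eq_mul]

section

variable {θ : Finset N → ℝ}

theorem IsFacetDefining.exists_eq_smul [Nontrivial N] (h : IsFacetDefining (exactCone N) θ)
    (hsum : ∑ S, θ S = 0) (hθ : properSum N θ = -1) {γ : Finset N → ℝ} (hγ : ∑ S, γ S = 0)
    (hF : ∀ m ∈ zeroFace (exactCone N) θ, γ ⬝ᵥ m = 0) : ∃ k : ℝ, γ = k • θ := by
  obtain ⟨p, hp, hpθ⟩ := exists_exactCone_dotProduct_ne_zero hsum hθ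
  obtain ⟨k, hk⟩ := (isFacet_zeroFace_iff zero_mem_exactCone h.1 hp hpθ).1 h.2 γ hF
  refine ⟨k, sub_eq_zero.1 (eq_zero_of_forall_exactCone ?_ fun m hm => ?_)⟩
  · simp [Finset.sum_sub_distrib, ← Finset.mul_sum, hγ, hsum]
  · rw [sub_dotProduct, smul_dotProduct, hk m hm, smul_eq_mul, sub_self]

/-- Facet-defining inequalities are extreme among the valid ones. -/
theorem IsFacetDefining.exists_eq_smul_of_eq_add [Nontrivial N]
    (h : IsFacetDefining (exactCone N) θ) (hθ : properSum N θ = -1) {T T' : Finset N}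
    {α δ : Finset N → ℝ} (hα : α ∈ tightDual T) (hδ : δ ∈ tightDual T') (h1 : θ = α + δ) :
    ∃ k : ℝ, α = k • θ := by
  refine h.exists_eq_smul ?_ hθ hα.1.1 fun m hm => ?_
  · rw [h1]
    simp [Finset.sum_add_distrib, hα.1.1, hδ.1.1]
  · have h2 := dotProduct_nonneg_of_mem_tightDual hα hm.1
    have h3 := dotProduct_nonneg_of_mem_tightDual hδ hm.1
    have h4 := hm.2
    rw [h1, add_dotProduct] at h4
    linarith

theorem IsFacetDefining.exists_mem_tightDual [Nontrivial N]
    (h : IsFacetDefining (exactCone N) θ) (hsum : ∑ S, θ S = 0) (hθ : properSum N θ = -1) :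
    ∃ T, θ ∈ tightDual T := by
  obtain ⟨s, β, -, hβ, hs⟩ := exists_eq_sum_tightDual hsum (θ := 0) (by simp)
    fun m hm _ => h.1 m hm
  rw [smul_zero, add_zero] at hs
  have hex : ∀ T, ∃ k : ℝ, β T = k • θ := fun T => by
    refine h.exists_eq_smul hsum hθ (hβ T).1.1 fun m hm => ?_
    refine (Finset.sum_eq_zero_iff_of_nonneg (s := Finset.univ) (f := fun T => β T ⬝ᵥ m)
      fun T _ => dotProduct_nonneg_of_mem_tightDual (hβ T) hm.1).1 ?_ T (Finset.mem_univ _)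
    rw [← sum_dotProduct, ← hs, hm.2]
  choose k hk using hex
  by_cases hk0 : ∀ T, k T = 0
  · have : θ = 0 := by rw [hs]; simp [hk, hk0]
    simp [this] at hθ
  · push Not at hk0
    obtain ⟨T, hT⟩ := hk0
    have hkT : 0 ≤ k T := by
      have := properSum_nonpos (hβ T)
      rw [hk T, map_smul, hθ, smul_eq_mul] at this
      linarith
    refine ⟨T, ?_⟩
    have := smul_mem_tightDual (inv_nonneg.2 hkT) (hβ T)
    rwa [hk T, inv_smul_smul₀ hT] at this

/-- The form in which extremality is used: a relation `α` whose negative coefficients occur only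
at negative coefficients of `θ` is a multiple of `θ`, since `θ - ε • α` remains valid for
small `ε > 0`. -/
theorem IsFacetDefining.exists_eq_smul_of_neg [Nontrivial N]
    (h : IsFacetDefining (exactCone N) θ) (hθ : properSum N θ = -1) {T T' : Finset N}
    (hθT : θ ∈ tightDual T) {α : Finset N → ℝ} (hα : α ∈ tightDual T')
    (hneg : ∀ L, L ≠ ∅ → L ≠ Finset.univ → L ≠ T → α L < 0 → θ L < 0) :
    ∃ k : ℝ, α = k • θ := by
  have hev : ∀ L, L ≠ ∅ → L ≠ Finset.univ → L ≠ T →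
      ∀ᶠ ε in nhdsWithin (0 : ℝ) (Set.Ioi 0), θ L - ε * α L ≤ 0 := by
    intro L h1 h2 h3
    by_cases hL : α L < 0
    · have hc : Filter.Tendsto (fun ε : ℝ => θ L - ε * α L) (nhds 0) (nhds (θ L - 0 * α L)) :=
        Continuous.tendsto (by fun_prop) 0
      rw [zero_mul, sub_zero] at hc
      exact ((hc.mono_left nhdsWithin_le_nhds).eventually_lt_const (hneg L h1 h2 h3 hL)).mono
        fun ε hε => hε.le
    · filter_upwards [self_mem_nhdsWithin] with ε hε
      have := mul_nonneg (le_of_lt hε) (not_lt.1 hL)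
      linarith [hθT.2 L h1 h2 h3]
  have hall : ∀ᶠ ε in nhdsWithin (0 : ℝ) (Set.Ioi 0), ∀ L, L ≠ ∅ → L ≠ Finset.univ → L ≠ T →
      θ L - ε * α L ≤ 0 := by
    simpa only [Filter.eventually_all, Filter.eventually_imp_distrib_left] using hev
  obtain ⟨ε, hε, hε0⟩ := (hall.and self_mem_nhdsWithin).exists
  have hε0 : 0 < ε := hε0
  obtain ⟨k, hk⟩ := h.exists_eq_smul_of_eq_add hθ (α := ε • α) (δ := θ - ε • α)
    (smul_mem_tightDual hε0.le hα)
    (show θ - ε • α ∈ tightDual T from ⟨sub_mem hθT.1 (Submodule.smul_mem _ _ hα.1), hε⟩)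
    (by abel)
  refine ⟨ε⁻¹ * k, ?_⟩
  rw [mul_smul, ← hk, inv_smul_smul₀ hε0.ne']

/-- The inequality `m(A) + m(Aᶜ) ≤ m(N)` is not facet-defining if there are at least three
players: if `B` is one of the two sets with at least two elements and `i ∈ B`, it is the sum of
the supermodularity inequalities for the pairs `Bᶜ`, `{i}` and `B`, `Bᶜ ∪ {i}`. -/
theorem IsFacetDefining.apply_compl_eq_zero [Nontrivial N] (hN : 3 ≤ Fintype.card N)
    (h : IsFacetDefining (exactCone N) θ) (hθ : properSum N θ = -1) (hθ0 : θ ∈ tightDual ∅)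
    {A : Finset N} (hA0 : A ≠ ∅) (hA1 : A ≠ Finset.univ) : θ A = 0 ∨ θ Aᶜ = 0 := by
  wlog hA2 : 2 ≤ A.card generalizing A
  · refine (this (A := Aᶜ) (by simpa using hA1) (by simpa using hA0) ?_).symm.imp_left ?_
    · rw [Finset.card_compl]; omega
    · rw [compl_compl]; exact id
  by_contra! hcon
  have hneg : ∀ L, L ≠ ∅ → L ≠ Finset.univ → θ L ≠ 0 → θ L < 0 := fun L h1 h2 h3 =>
    lt_of_le_of_ne (hθ0.2 L h1 h2 h1) h3
  have hne : (Finset.univ : Finset N) ≠ ∅ := Finset.univ_nonempty.ne_empty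
  have hcompl0 : Aᶜ ≠ ∅ := by simpa using hA1
  have hcompl1 : Aᶜ ≠ Finset.univ := by simpa using hA0
  have hAc : A ≠ Aᶜ := by
    obtain ⟨i, hi⟩ := Finset.nonempty_iff_ne_empty.2 hA0
    intro heq
    exact Finset.mem_compl.1 (heq ▸ hi) hi
  obtain ⟨i, hi⟩ := Finset.nonempty_iff_ne_empty.2 hA0
  let ζ : Finset N → ℝ :=
    Pi.single Finset.univ 1 + Pi.single ∅ 1 - Pi.single A 1 - Pi.single Aᶜ 1
  let ζ₁ : Finset N → ℝ :=
    Pi.single (insert i Aᶜ) 1 + Pi.single ∅ 1 - Pi.single {i} 1 - Pi.single Aᶜ 1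
  let ζ₂ : Finset N → ℝ :=
    Pi.single Finset.univ 1 + Pi.single {i} 1 - Pi.single A 1 - Pi.single (insert i Aᶜ) 1
  have hζ : ζ ∈ tightDual ∅ := by
    refine ⟨?_, fun L h1 h2 _ => ?_⟩
    · have := single_modular_mem_nullSpace A Aᶜ
      rwa [Finset.union_compl, Finset.inter_compl] at this
    · simp only [ζ, Pi.sub_apply, Pi.add_apply, Pi.single_apply, h1, h2, if_false]
      split_ifs <;> norm_num
  have hζ₁ : ζ₁ ∈ tightDual (insert i Aᶜ) := by
    refine ⟨?_, fun L h1 h2 h3 => ?_⟩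
    · have := single_modular_mem_nullSpace {i} Aᶜ
      rwa [← Finset.insert_eq, Finset.singleton_inter_of_notMem (by simpa using hi)] at this
    · simp only [ζ₁, Pi.sub_apply, Pi.add_apply, Pi.single_apply, h1, h3, if_false]
      split_ifs <;> norm_num
  have hζ₂ : ζ₂ ∈ tightDual {i} := by
    refine ⟨?_, fun L h1 h2 h3 => ?_⟩
    · have := single_modular_mem_nullSpace A (insert i Aᶜ)
      rwa [Finset.union_insert, Finset.union_compl, Finset.insert_eq_of_mem (Finset.mem_univ i),
        Finset.inter_insert_of_mem hi, Finset.inter_compl, Finset.insert_empty] at this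
    · simp only [ζ₂, Pi.sub_apply, Pi.add_apply, Pi.single_apply, h2, h3, if_false]
      split_ifs <;> norm_num
  obtain ⟨k, hk⟩ := h.exists_eq_smul_of_neg hθ hθ0 hζ fun L h1 h2 _ hL => by
    refine hneg L h1 h2 ?_
    simp only [ζ, Pi.sub_apply, Pi.add_apply, Pi.single_apply, h1, h2, if_false] at hL
    split_ifs at hL with h4 h5 h5
    · exact h4 ▸ hcon.1
    · exact h4 ▸ hcon.1
    · exact h5 ▸ hcon.2
    · norm_num at hL
  have hkpos : 0 < k := by
    have h1 := congrFun hk A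
    have h2 := hneg A hA0 hA1 hcon.1
    simp only [ζ, Pi.sub_apply, Pi.add_apply, Pi.single_apply, hA0, hA1, hAc, if_false, if_true,
      Pi.smul_apply, smul_eq_mul] at h1
    nlinarith
  obtain ⟨k', hk'⟩ := h.exists_eq_smul_of_eq_add hθ (smul_mem_tightDual (inv_nonneg.2 hkpos.le) hζ₁)
    (smul_mem_tightDual (inv_nonneg.2 hkpos.le) hζ₂) (by
      have : ζ₁ + ζ₂ = ζ := by simp only [ζ, ζ₁, ζ₂]; abel
      rw [← smul_add, this, hk, inv_smul_smul₀ hkpos.ne'])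
  have hiA : A ≠ {i} := by rintro rfl; simp at hA2
  have hinsA : A ≠ insert i Aᶜ := by
    obtain ⟨j, hj⟩ := Finset.nonempty_iff_ne_empty.2 hcompl0
    intro heq
    exact Finset.mem_compl.1 hj (heq ▸ Finset.mem_insert_of_mem hj)
  have hk'0 : k' = 0 := by
    have h1 := congrFun hk' A
    simp only [ζ₁, Pi.smul_apply, Pi.sub_apply, Pi.add_apply, Pi.single_apply, hA0, hiA, hinsA,
      hAc, if_false, smul_eq_mul, add_zero, sub_zero, mul_zero] at h1
    exact (mul_eq_zero.1 h1.symm).resolve_right hcon.1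
  have h1 := congrFun hk' Aᶜ
  have h2 : Aᶜ ≠ insert i Aᶜ := fun heq =>
    Finset.mem_compl.1 (heq ▸ Finset.mem_insert_self i Aᶜ) hi
  have h3 : Aᶜ ≠ {i} := fun heq =>
    Finset.mem_compl.1 (heq ▸ Finset.mem_singleton_self i) hi
  simp only [ζ₁, Pi.smul_apply, Pi.sub_apply, Pi.add_apply, Pi.single_apply, hcompl0, h2, h3,
    if_false, if_true, smul_eq_mul, hk'0] at h1
  have := inv_pos.2 hkpos
  linarith

/-- The support of a facet-defining inequality is an indecomposable min-semi-balanced system. -/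
theorem IsFacetDefining.exists_isIndecomposable [Nontrivial N] (hN : 3 ≤ Fintype.card N)
    (h : IsFacetDefining (exactCone N) θ) (hsum : ∑ S, θ S = 0) (hθ : properSum N θ = -1) :
    ∃ 𝒮 : Finset (Finset N), IsIndecomposable 𝒮 ∧ IsThetaOf θ 𝒮 := by
  obtain ⟨T, hT⟩ := h.exists_mem_tightDual hsum hθ
  let 𝒮 : Finset (Finset N) := Finset.univ.filter fun L => L ≠ ∅ ∧ L ≠ Finset.univ ∧ θ L ≠ 0
  have hmem : ∀ L, L ∈ 𝒮 ↔ L ≠ ∅ ∧ L ≠ Finset.univ ∧ θ L ≠ 0 := fun L => by simp [𝒮]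
  have hθ0 : ∀ L ∈ 𝒮, θ L ≠ 0 := fun L hL => ((hmem L).1 hL).2.2
  have hθ1 : ∀ L, L ≠ ∅ → L ≠ Finset.univ → L ∉ 𝒮 → θ L = 0 := fun L h1 h2 h3 => by
    by_contra h4
    exact h3 ((hmem L).2 ⟨h1, h2, h4⟩)
  have hneg : ∀ L ∈ 𝒮, L ≠ T → θ L < 0 := fun L hL hLT =>
    lt_of_le_of_ne (hT.2 L ((hmem L).1 hL).1 ((hmem L).1 hL).2.1 hLT) (hθ0 L hL)
  have hnt : IsNontrivial 𝒮 := by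
    refine ⟨?_, by simp [𝒮], by simp [𝒮]⟩
    by_contra hempty
    rw [Finset.not_nonempty_iff_eq_empty] at hempty
    have : θ = 0 := eq_zero_of_proper_eq_zero hT.1 fun L h1 h2 => hθ1 L h1 h2 (by simp [hempty])
    simp [this] at hθ
  have hmin : IsMinSemiBalanced 𝒮 := by
    refine ⟨⟨hnt, -θ, θ Finset.univ, by simpa using hθ0, isSemiConic_of_forall_nonneg (T := T)
      fun S hS hST => ?_, yieldsConst_of_mem_nullSpace hnt hT.1 hθ1⟩, ?_⟩
    · simpa using (hneg S hS hST).le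
    · rintro 𝒮' ⟨hnt', c, r, hc0, hc, hcr⟩ hle L hL
      obtain ⟨T', hT', -⟩ := hc.exists_forall_nonneg
      obtain ⟨k, hk⟩ := h.exists_eq_smul_of_neg hθ hT (relVec_mem_tightDual hcr hT')
        fun L h1 h2 h3 h4 => by
          rw [relVec_apply h1 h2] at h4
          split_ifs at h4 with h5
          · exact hneg L (hle h5) h3
          · simp at h4
      obtain ⟨S, hS⟩ := hnt'.1
      have hk0 : k ≠ 0 := by
        rintro rfl
        have := congrFun hk S
        rw [relVec_apply_of_mem hnt' hS] at this
        exact hc0 S hS (by simpa using this)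
      have h1 := congrFun hk L
      rw [relVec_apply ((hmem L).1 hL).1 ((hmem L).1 hL).2.1] at h1
      by_contra hL'
      rw [if_neg hL', neg_zero, Pi.smul_apply, smul_eq_mul] at h1
      exact mul_ne_zero hk0 (hθ0 L hL) h1.symm
  have hbal : ¬ IsBalanced 𝒮 := by
    rintro ⟨-, c, hc, hcr⟩
    have hcr' : YieldsConst 𝒮 c 1 := by
      rw [YieldsConst, hcr]; funext i; simp [chi]
    obtain ⟨k, hk⟩ := hmin.exists_eq_smul hT hθ0 hθ1
      (relVec_mem_nullSpace hcr') fun L h1 h2 h3 => by rw [relVec_apply h1 h2, if_neg h3, neg_zero]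
    have hkpos : 0 < k := by
      have h1 := congrArg (properSum N) hk
      rw [properSum_relVec hnt, map_smul, hθ, smul_eq_mul] at h1
      have h2 := Finset.sum_pos hc hnt.1
      linarith
    have hnegall : ∀ L ∈ 𝒮, θ L < 0 := fun L hL => by
      have h1 := congrFun hk L
      rw [relVec_apply_of_mem hnt hL, Pi.smul_apply, smul_eq_mul] at h1
      nlinarith [hc L hL]
    have hT0 : ∀ T', θ ∈ tightDual T' := fun T' => ⟨hT.1, fun L h1 h2 _ => by
      by_cases hL : L ∈ 𝒮
      · exact (hnegall L hL).le
      · exact (hθ1 L h1 h2 hL).le⟩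
    obtain ⟨A, hA⟩ := hnt.1
    have hA0 := hnt.ne_empty hA
    have hA1 := hnt.ne_univ hA
    have hAc : θ Aᶜ = 0 := (h.apply_compl_eq_zero hN hθ (hT0 ∅) hA0 hA1).resolve_left (hθ0 A hA)
    have hne : A ≠ Aᶜ := fun heq => hθ0 A hA (heq ▸ hAc)
    -- Replace `χ_A` by `χ_N - χ_{Aᶜ}`: this makes `Aᶜ` exceptional within `𝒮 ∪ {Aᶜ}`.
    let α : Finset N → ℝ := θ +
      θ A • (Pi.single (A ∪ Aᶜ) 1 + Pi.single (A ∩ Aᶜ) 1 - Pi.single A 1 - Pi.single Aᶜ 1)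
    have hαL : ∀ L, L ≠ ∅ → L ≠ Finset.univ →
        α L = θ L - (if L = A then θ A else 0) - if L = Aᶜ then θ A else 0 := by
      intro L h1 h2
      simp only [α, Finset.union_compl, Finset.inter_compl, Pi.add_apply, Pi.sub_apply,
        Pi.smul_apply, smul_eq_mul, Pi.single_apply, h1, h2, if_false]
      split_ifs <;> ring
    have hαc : α Aᶜ = -θ A := by
      rw [hαL _ (by simpa using hA1) (by simpa using hA0), if_neg hne.symm, if_pos rfl, hAc]
      ring
    have hα : α ∈ tightDual Aᶜ := by
      refine ⟨add_mem hT.1 (Submodule.smul_mem _ _ (single_modular_mem_nullSpace A Aᶜ)),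
        fun L h1 h2 h3 => ?_⟩
      rw [hαL L h1 h2, if_neg h3]
      split_ifs with h4
      · simp [h4]
      · simpa using (hT0 ∅).2 L h1 h2 h1
    obtain ⟨k', hk'⟩ := h.exists_eq_smul_of_neg hθ (hT0 Aᶜ) hα fun L h1 h2 h3 h4 => by
      rw [hαL L h1 h2, if_neg h3] at h4
      split_ifs at h4 with h5
      · simp [h5] at h4
      · simpa using h4
    have h1 := congrFun hk' Aᶜ
    rw [hαc, Pi.smul_apply, hAc, smul_zero, neg_eq_zero] at h1
    exact hθ0 A hA h1
  refine ⟨𝒮, ⟨⟨hmin, hbal⟩, ?_⟩, ?_⟩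
  · rintro ⟨E, hE, hE0, hE1, hnt', -, c, r, hcE, hc, hcr⟩
    have hcmem := relVec_mem_tightDual hcr hc
    obtain ⟨k, hk⟩ := h.exists_eq_smul_of_neg hθ hT hcmem fun L h1 h2 h3 h4 => by
      by_cases hL : L ∈ 𝒮
      · exact hneg L hL h3
      · rw [relVec_apply h1 h2] at h4
        split_ifs at h4 with h5
        · rw [(Finset.mem_insert.1 h5).resolve_right hL] at h4
          linarith
        · simp at h4
    have h1 := congrFun hk E
    rw [relVec_apply_of_mem hnt' (Finset.mem_insert_self _ _), Pi.smul_apply, hθ1 E hE0 hE1 hE,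
      smul_zero, neg_eq_zero] at h1
    exact hcE.ne h1
  · obtain ⟨θ', T', hθ', hθ'T, -, hθ'1, hθ's⟩ := hmin.exists_isThetaOf
    obtain ⟨k, rfl⟩ := hmin.exists_eq_smul hT hθ0 hθ1 hθ'T.1 hθ'1
    rw [map_smul, hθ, smul_eq_mul] at hθ's
    obtain rfl : k = 1 := by linarith
    rwa [one_smul] at hθ'

end

/-- Every facet is the zero set of a normalised valid inequality: a linear functional attaining
its maximum on a cone is non-positive there, and the maximum is zero. -/
theorem exists_eq_zeroFace_of_isFacet [Nontrivial N] {F : Set (Finset N → ℝ)}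
    (hF : IsFacet (exactCone N) F) :
    ∃ θ : Finset N → ℝ, ∑ S, θ S = 0 ∧ properSum N θ = -1 ∧ F = zeroFace (exactCone N) θ ∧
      IsFacetDefining (exactCone N) θ := by
  obtain ⟨l, hl⟩ := hF.1 hF.2.1
  obtain ⟨θ₀, hθ₀⟩ : ∃ θ₀ : Finset N → ℝ, ∀ m, θ₀ ⬝ᵥ m = -l m := by
    refine ⟨fun S => -l (Pi.single S 1), fun m => ?_⟩
    conv_rhs => rw [pi_eq_sum_univ' m]
    simp [dotProduct, mul_comm]
  obtain ⟨θ₁, hsum, hθ₁⟩ := exists_sum_eq_zero_dotProduct_eq θ₀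
  have hval : ∀ x ∈ exactCone N, (∀ y ∈ exactCone N, l y ≤ l x) → l x = 0 := by
    intro x hx hmax
    have h1 := hmax 0 zero_mem_exactCone
    have h2 := hmax _ (smul_mem_exactCone zero_le_two hx)
    simp only [map_zero, map_smul, smul_eq_mul] at h1 h2
    linarith
  have hpos : ∀ m ∈ exactCone N, 0 ≤ θ₁ ⬝ᵥ m := by
    obtain ⟨x, hx⟩ := hF.2.1
    rw [hl] at hx
    intro m hm
    rw [hθ₁ m hm, hθ₀]
    linarith [hx.2 m hm, hval x hx.1 hx.2]
  have hface : F = zeroFace (exactCone N) θ₁ := by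
    rw [hl]
    ext m
    refine and_congr_right fun hm => ⟨fun h => ?_, fun h y hy => ?_⟩
    · rw [hθ₁ m hm, hθ₀, hval m hm h, neg_zero]
    · rw [hθ₁ m hm, hθ₀] at h
      have := hpos y hy
      rw [hθ₁ y hy, hθ₀] at this
      linarith
  obtain ⟨s, β, -, hβ, hs⟩ := exists_eq_sum_tightDual hsum (θ := 0) (by simp)
    fun m hm _ => hpos m hm
  rw [smul_zero, add_zero] at hs
  have hle : properSum N θ₁ ≤ 0 := by
    rw [hs, map_sum]
    exact Finset.sum_nonpos fun T _ => properSum_nonpos (hβ T)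
  have hne : properSum N θ₁ ≠ 0 := by
    intro h0
    have h1 : ∀ T, β T = 0 := fun T => by
      rw [hs, map_sum] at h0
      exact eq_zero_of_properSum_eq_zero (hβ T) ((Finset.sum_eq_zero_iff_of_nonpos
        fun T _ => properSum_nonpos (hβ T)).1 h0 T (Finset.mem_univ T))
    have h2 : F = exactCone N := by
      rw [hface, hs]
      ext m
      simp [zeroFace, h1]
    have h3 := hF.2.2
    rw [h2] at h3
    omega
  have hlt : 0 < -properSum N θ₁ := by
    have := lt_of_le_of_ne hle hne
    linarith
  have hface' : zeroFace (exactCone N) ((-properSum N θ₁)⁻¹ • θ₁) = zeroFace (exactCone N) θ₁ := by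
    ext m
    simp only [zeroFace, Set.mem_ofPred_eq, smul_dotProduct, smul_eq_mul, mul_eq_zero,
      inv_eq_zero, hlt.ne', false_or]
  refine ⟨(-properSum N θ₁)⁻¹ • θ₁, ?_, ?_, hface.trans hface'.symm, fun m hm => ?_, ?_⟩
  · simp [← Finset.mul_sum, hsum]
  · rw [map_smul, smul_eq_mul]
    field_simp
  · rw [smul_dotProduct]
    exact mul_nonneg (inv_nonneg.2 hlt.le) (hpos m hm)
  · rw [hface', ← hface]
    exact hF

end ExactGames

theorem theorem1 {N : Type*} [Fintype N] [DecidableEq N] (hN : 3 ≤ Fintype.card N) :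
    (∀ θ : Finset N → ℝ,
      ∑ S, θ S = 0 →
      ∑ L ∈ (Finset.univ : Finset (Finset N)) \ {∅, Finset.univ}, θ L = -1 →
      (IsFacetDefining (exactCone N) θ ↔
        ∃ 𝒮 : Finset (Finset N), IsIndecomposable 𝒮 ∧ IsThetaOf θ 𝒮)) ∧
    (∀ 𝒮 : Finset (Finset N), IsIndecomposable 𝒮 →
      ∃ θ : Finset N → ℝ, IsThetaOf θ 𝒮 ∧ IsFacet (exactCone N) (zeroFace (exactCone N) θ)) ∧
    (∀ F : Set (Finset N → ℝ), IsFacet (exactCone N) F →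
      ∃! 𝒮 : Finset (Finset N), IsIndecomposable 𝒮 ∧
        ∃ θ : Finset N → ℝ, IsThetaOf θ 𝒮 ∧ F = zeroFace (exactCone N) θ) := by
  have : Nontrivial N := Fintype.one_lt_card_iff_nontrivial.1 (by omega)
  refine ⟨fun θ hsum hθ => ⟨fun h => ?_, ?_⟩, fun 𝒮 h𝒮 => ?_, fun F hF => ?_⟩
  · exact h.exists_isIndecomposable hN hsum ((properSum_apply θ).trans hθ)
  · rintro ⟨𝒮, h𝒮, hθ⟩
    exact h𝒮.isFacetDefining hθ
  · obtain ⟨θ, -, hθ, -⟩ := h𝒮.1.1.exists_isThetaOf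
    exact ⟨θ, hθ, (h𝒮.isFacetDefining hθ).2⟩
  · obtain ⟨θ, hsum, hθ, rfl, hfd⟩ := exists_eq_zeroFace_of_isFacet hF
    obtain ⟨𝒮, h𝒮, hθ𝒮⟩ := hfd.exists_isIndecomposable hN hsum hθ
    refine ⟨𝒮, ⟨h𝒮, θ, hθ𝒮, rfl⟩, ?_⟩
    rintro 𝒮' ⟨h𝒮', θ', hθ𝒮', hface⟩
    obtain ⟨-, -, hθ0, hθ1, -⟩ := h𝒮.1.1.of_isThetaOf hθ𝒮
    obtain ⟨T', hθ'T, hθ'0, hθ'1, hθ's⟩ := h𝒮'.1.1.of_isThetaOf hθ𝒮'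
    obtain ⟨k, rfl⟩ := hfd.exists_eq_smul hsum hθ hθ'T.1.1 fun m hm => (hface ▸ hm).2
    rw [map_smul, hθ, smul_eq_mul] at hθ's
    obtain rfl : k = 1 := by linarith
    rw [one_smul] at hθ'0 hθ'1
    ext L
    refine ⟨fun hL => ?_, fun hL => ?_⟩ <;> by_contra hL'
    · exact hθ'0 L hL (hθ1 L (h𝒮'.1.1.1.1.ne_empty hL) (h𝒮'.1.1.1.1.ne_univ hL) hL')
    · exact hθ0 L hL (hθ'1 L (h𝒮.1.1.1.1.ne_empty hL) (h𝒮.1.1.1.1.ne_univ hL) hL')
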